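/- All graphs are finite directed graphs $E=(E^0,E^1,r,s)$; loops and multiple edges are allowed. A cycle is a nontrivial closed path $\mu_1\cdots\mu_k$ with pairwise distinct sources $s(\mu_i)$; an exit of it is an edge $e\neq\mu_i$ with $s(e)=s(\mu_i)$ for some $i$. The rose $L_n$ ($n\ge 0$) is the graph with one vertex and $n$ loops. A graph $E$ is a polycephaly graph, with cycles $C_{l_1},\dots,C_{l_h}$ (of lengths $l_s\ge1$) and roses $L_{n_{h+1}},\dots,L_{n_t}$ ($n_s\ge 0$) attached to distinct vertices $v_{h+1},\dots,v_t$, if the given cycles and roses are mutually disjoint, none of the cycles has an exit, every edge with source $v_s$ ($h+1\le s\le t$) is one of the $n_s$ petals (loops) of $L_{n_s}$, $E$ has no cycles (up to rotation) other than the $C_{l_s}$ and the petals of the roses, and from every vertex there is a path (possibly of length $0$) to a vertex of some $C_{l_s}$ or to some $v_s$ with $h+1\le s\le t$. (A vertex with exactly one loop and no other outgoing edge may be listed either as a cycle of length $1$ or as a rose $L_1$.) For $1\le s\le h$ choose any vertex $v_s$ of $C_{l_s}$. Let $E_1$ be the acyclic graph obtained from $E$ by removing, for $1\le s\le h$, the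 edge of $C_{l_s}$ with source $v_s$ and, for $h+1\le s\le t$, all petals of $L_{n_s}$; let $p^{v_s}_1,\dots,p^{v_s}_{n(v_s)}$ be all the paths in $E_1$ (including the trivial one) which end in $v_s$, with lengths $|p^{v_s}_i|$. For a field $K$, the Leavitt path algebra $\mathcal L_K(E)$ is the $K$-algebra generated by $E^0\cup\{\alpha,\alpha^*\mid\alpha\in E^1\}$ with relations $vw=\delta_{vw}v$; $s(\alpha)\alpha=\alpha r(\alpha)=\alpha$; $r(\alpha)\alpha^*=\alpha^*s(\alpha)=\alpha^*$; $\alpha^*\beta=\delta_{\alpha\beta}r(\alpha)$; $\sum_{s(\alpha)=v}\alpha\alpha^*=v$ whenever $v$ emits an edge. It is $\mathbb Z$-graded by $\deg v=0$, $\deg\alpha=1$, $\deg\alpha^*=-1$. Put $\mathcal L_K(1,n)=\mathcal L_K(L_n)$. The tensor product $A\otimes_KB$ of graded algebras has degree-$k$ component spanned by the $a\otimes b$ with $a,b$ homogeneous and $\deg a+\deg b=k$. For a $\mathbb Z$-graded ring $A$, the group ring $A[\mathbb Z]$ has degree-$k$ component $\bigoplus_{i+j=k}A_i\,j$. The matrix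 algebra $\mathbb M_{n(v_s)}(K)$ is graded by $\deg e_{ij}=|p^{v_s}_i|-|p^{v_s}_j|$. Theorem. Let $K$ be a field and $E$ a polycephaly graph as above. (1) If $h=0$ and there is $n\ge0$ with $L_{n_s}=L_n$ for all $1\le s\le t$, then there is a $\mathbb Z$-graded isomorphism of $K$-algebras $$\mathcal L_K(E)\cong_{\mathrm{gr}}\mathcal L_K(E_1)\otimes_K\mathcal L_K(1,n).$$ (2) There is a $\mathbb Z$-graded isomorphism of $K$-algebras of $\mathcal L_K(E)$ with the group ring $$\Big(\bigoplus_{s=1}^t\mathbb M_{n(v_s)}(K)\Big)[\mathbb Z]=\bigoplus_{s=1}^t\mathbb M_{n(v_s)}(K)[\mathbb Z]$$ if and only if $l_s=1$ for all $1\le s\le h$ and $n_s=1$ for all $h+1\le s\le t$. Moreover, this condition on the $l_s$ and $n_s$ already holds if $\mathcal L_K(E)$ is isomorphic, as a $\mathbb Z$-graded ring, to the group ring $A[\mathbb Z]$ of any $\mathbb Z$-graded ring $A$. -/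

import Mathlib

/-- A directed graph with vertex set `V`, edge set `E`, source map and range map
(loops and parallel edges are allowed). -/
structure DirGraph (V E : Type*) where
  src : E → V
  rng : E → V

namespace DirGraph

section Graphs

variable {V E : Type*} (G : DirGraph V E)

/-- `G.IsPath v p w`: the list of edges `p` is a path with source `v` and range `w`; the empty
list is the trivial path at `v`. The length of the path is `p.length`. -/
def IsPath : V → List E → V → Prop
  | v, [], w => v = w
  | v, e :: p, w => G.src e = v ∧ IsPath (G.rng e) p w

/-- `v ≥ w`: there is a path, possibly trivial, from `v` to `w`. -/
def Reaches (v w : V) : Prop := ∃ p, G.IsPath v p w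

/-- A cycle based at `v`: a nontrivial closed path whose edges have distinct sources. -/
def IsCycle (v : V) (p : List E) : Prop :=
  p ≠ [] ∧ G.IsPath v p v ∧ (p.map G.src).Nodup

/-- The rose with `k` petals: one vertex and `k` loops. -/
def rose (k : ℕ) : DirGraph Unit (Fin k) where
  src _ := ()
  rng _ := ()

/-- The paths of `G` with range `v`. -/
structure PathInto (v : V) where
  start : V
  edges : List E
  isPath : G.IsPath start edges v

/-- A presentation of `G` as a polycephaly graph: cycles without exits and roses without exits,
mutually disjoint, such that there is no cycle besides the given cycles and the petals of the
given roses, and such that every vertex is connected to a given cycle or to a given rose.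
A rose may have no petals (then it is a sink of `G`). -/
structure Polycephaly where
  /-- The number `h` of cycles. -/
  numCycles : ℕ
  /-- The number `t - h` of roses. -/
  numRoses : ℕ
  /-- The edges of the `s`-th cycle. -/
  cyc : Fin numCycles → List E
  /-- The chosen vertex `v_s` of the `s`-th cycle. -/
  cycVertex : Fin numCycles → V
  /-- The vertex `v_s` to which the `s`-th rose is attached; the petals are the edges with this
  source. -/
  roseVertex : Fin numRoses → V
  isCycle : ∀ s, G.IsCycle (cycVertex s) (cyc s)
  cyc_disjoint : ∀ s s', s ≠ s' → ∀ e ∈ cyc s, ∀ e' ∈ cyc s', G.src e ≠ G.src e'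
  roseVertex_injective : Function.Injective roseVertex
  cyc_rose_disjoint : ∀ s, ∀ e ∈ cyc s, ∀ s', G.src e ≠ roseVertex s'
  cyc_no_exit : ∀ s, ∀ e ∈ cyc s, ∀ f, G.src f = G.src e → f ∈ cyc s
  rose_no_exit : ∀ s e, G.src e = roseVertex s → G.rng e = roseVertex s
  /-- Every cycle of `G` is based at a vertex of one of the given cycles or roses; as these have no
  exits, it is one of the given cycles, up to rotation, or a petal of one of the given roses. -/
  no_other_cycle : ∀ v p, G.IsCycle v p →
    (∃ s, ∃ e ∈ cyc s, G.src e = v) ∨ ∃ s, roseVertex s = v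
  connected_to_head : ∀ v,
    (∃ s, ∃ e ∈ cyc s, G.Reaches v (G.src e)) ∨ ∃ s, G.Reaches v (roseVertex s)

namespace Polycephaly

variable {G} (P : G.Polycephaly)

/-- The number `n_s` of petals of the `s`-th rose. -/
noncomputable def numPetals (s : Fin P.numRoses) : ℕ :=
  Nat.card {e : E // G.src e = P.roseVertex s}

/-- The vertices `v_1, …, v_t`: first those chosen on the cycles, then those of the roses. -/
def head : Fin P.numCycles ⊕ Fin P.numRoses → V :=
  Sum.elim P.cycVertex P.roseVertex

/-- The graph `E_1`: from each cycle the edge with source `v_s` is removed (by the absence of exits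
it is the only edge of `G` with this source), and from each rose all petals are removed. -/
def residual : DirGraph V {e : E // ∀ s, G.src e ≠ P.head s} where
  src e := G.src e
  rng e := G.rng e

end Polycephaly

/-! Paths of the residual graph with a given range are finite in number. -/

theorem IsPath.end_mem_of_closed {S : V → Prop} {p : List E}
    (hS : ∀ e ∈ p, S (G.src e) → S (G.rng e)) {v w : V} (hp : G.IsPath v p w) (hv : S v) :
    S w := by
  induction p generalizing v with
  | nil => exact hp ▸ hv
  | cons e p ih =>
    obtain ⟨rfl, hp⟩ := hp
    exact ih (fun f hf => hS f (List.mem_cons_of_mem _ hf)) hp (hS e List.mem_cons_self hv)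

theorem IsPath.append_right {p q : List E} {v w : V} (h : G.IsPath v (p ++ q) w) :
    ∃ u, G.IsPath v p u ∧ G.IsPath u q w := by
  induction p generalizing v with
  | nil => exact ⟨v, rfl, h⟩
  | cons e p ih =>
    obtain ⟨h1, h2⟩ := h
    obtain ⟨u, hu, hu'⟩ := ih h2
    exact ⟨u, ⟨h1, hu⟩, hu'⟩

theorem IsPath.rng_mem {p : List E} {v w : V} (h : G.IsPath v p w) {e : E} (he : e ∈ p) :
    G.rng e = w ∨ ∃ f ∈ p, G.src f = G.rng e := by
  induction p generalizing v with
  | nil => simp at he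
  | cons f p ih =>
    obtain ⟨-, h2⟩ := h
    rcases List.mem_cons.1 he with rfl | he
    · cases p with
      | nil => exact Or.inl h2
      | cons g p => exact Or.inr ⟨g, by simp, h2.1⟩
    · rcases ih h2 he with h | ⟨g, hg, hg'⟩
      · exact Or.inl h
      · exact Or.inr ⟨g, List.mem_cons_of_mem _ hg, hg'⟩

theorem IsPath.nodup_of_acyclic (hG : ∀ v p, ¬ G.IsCycle v p) {p : List E} {v w : V}
    (h : G.IsPath v p w) : (p.map G.src).Nodup := by
  induction p generalizing v with
  | nil => simp
  | cons e p ih =>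
    obtain ⟨rfl, h2⟩ := h
    have hn := ih h2
    refine List.nodup_cons.2 ⟨fun hmem => ?_, hn⟩
    obtain ⟨f, hf, hfe⟩ := List.mem_map.1 hmem
    obtain ⟨q, r, rfl⟩ := List.append_of_mem hf
    obtain ⟨u, hu, hu'⟩ := IsPath.append_right G h2
    obtain ⟨rfl, -⟩ := hu'
    rw [List.map_append, List.nodup_append] at hn
    refine hG (G.src e) (e :: q) ⟨by simp, ⟨rfl, hfe ▸ hu⟩, List.nodup_cons.2 ⟨fun hq => ?_, hn.1⟩⟩
    exact hn.2.2 _ hq (G.src f) (by simp) hfe.symm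

theorem finite_pathInto_of_acyclic [Finite V] [Finite E] (hG : ∀ v p, ¬ G.IsCycle v p) (w : V) :
    Finite (G.PathInto w) := by
  have hfin : {l : List E | l.length ≤ Nat.card V}.Finite := List.finite_length_le E _
  have : Finite {l : List E // l.length ≤ Nat.card V} := hfin.to_subtype
  refine Finite.of_injective
    (β := V × {l : List E // l.length ≤ Nat.card V})
    (fun p => (p.start, ⟨p.edges, ?_⟩)) ?_
  · have := Fintype.ofFinite V
    have h := (IsPath.nodup_of_acyclic G hG p.isPath).length_le_card
    rwa [List.length_map, ← Nat.card_eq_fintype_card] at h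
  · rintro ⟨v, p, hp⟩ ⟨v', p', hp'⟩ h
    simp only [Prod.mk.injEq, Subtype.mk.injEq] at h
    obtain ⟨rfl, rfl⟩ := h
    rfl

namespace Polycephaly

variable {G} (P : G.Polycephaly)

theorem isPath_of_residual {p : List {e : E // ∀ s, G.src e ≠ P.head s}} {v w : V}
    (h : P.residual.IsPath v p w) : G.IsPath v (p.map Subtype.val) w := by
  induction p generalizing v with
  | nil => exact h
  | cons e p ih => exact ⟨h.1, ih h.2⟩

theorem residual_acyclic (v : V) (p : List {e : E // ∀ s, G.src e ≠ P.head s}) :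
    ¬ P.residual.IsCycle v p := by
  rintro ⟨hne, hp, hnd⟩
  have hpG := P.isPath_of_residual hp
  have hcyc : G.IsCycle v (p.map Subtype.val) :=
    ⟨fun h => hne (List.map_eq_nil_iff.1 h), hpG, by rw [List.map_map]; exact hnd⟩
  have hv : ∃ e ∈ p, G.src e.1 = v := by
    cases p with
    | nil => exact absurd rfl hne
    | cons e p => exact ⟨e, by simp, hp.1⟩
  rcases P.no_other_cycle v _ hcyc with ⟨s, g, hg, rfl⟩ | ⟨s, hs⟩
  · obtain ⟨q, r, hqr⟩ := List.append_of_mem hg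
    have hC := (P.isCycle s).2.1
    rw [hqr] at hC
    obtain ⟨u, -, hu⟩ := IsPath.append_right G hC
    have hu' : G.src g = u := hu.1
    subst hu'
    have hend : ∃ e ∈ p, G.src e.1 = P.cycVertex s := by
      refine IsPath.end_mem_of_closed G (S := fun x => ∃ e ∈ p, G.src e.1 = x) ?_ hu hv
      rintro f hf ⟨e, he, hef⟩
      have hfC : f ∈ P.cyc s := by rw [hqr]; exact List.mem_append_right _ hf
      have heC : e.1 ∈ P.cyc s := P.cyc_no_exit s f hfC _ hef
      have : e.1 = f := List.inj_on_of_nodup_map (P.isCycle s).2.2 heC hfC hef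
      subst this
      rcases IsPath.rng_mem G hpG (List.mem_map_of_mem he) with h | ⟨k, hk, hk'⟩
      · rw [h]; exact hv
      · obtain ⟨k', hk1, rfl⟩ := List.mem_map.1 hk
        exact ⟨k', hk1, hk'⟩
    obtain ⟨e, -, he⟩ := hend
    exact e.2 (Sum.inl s) he
  · obtain ⟨e, -, he⟩ := hv
    exact e.2 (Sum.inr s) (he.trans hs.symm)

noncomputable instance [Finite V] [Finite E] (w : V) : Fintype (P.residual.PathInto w) :=
  have := P.residual.finite_pathInto_of_acyclic P.residual_acyclic w
  Fintype.ofFinite _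

noncomputable instance (w : V) : DecidableEq (P.residual.PathInto w) :=
  Classical.decEq _

end Polycephaly

end Graphs

end DirGraph

/-! ### Leavitt path algebras -/

section Leavitt

variable (K : Type*) [Field K] {V E : Type*} (G : DirGraph V E)

/-- The generators `v`, `α`, `α*`. -/
inductive LeavittGen (V E : Type*) where
  | vert : V → LeavittGen V E
  | edge : E → LeavittGen V E
  | ghost : E → LeavittGen V E

/-- `deg v = 0`, `deg α = 1`, `deg α* = -1`. -/
def LeavittGen.deg {V E : Type*} : LeavittGen V E → ℤ
  | vert _ => 0
  | edge _ => 1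
  | ghost _ => -1

open LeavittGen in
/-- The defining relations of the Leavitt path algebra of a finite graph. The last one is
needed because the free algebra used here has an identity: in the (non-unital) algebra given by
the other relations, the sum of all vertices is the identity as soon as there are only finitely
many vertices. -/
inductive LeavittRel :
    FreeAlgebra K (LeavittGen V E) → FreeAlgebra K (LeavittGen V E) → Prop
  | vert_self (v : V) :
      LeavittRel (FreeAlgebra.ι K (vert v) * FreeAlgebra.ι K (vert v)) (FreeAlgebra.ι K (vert v))
  | vert_ne (v w : V) (h : v ≠ w) :
      LeavittRel (FreeAlgebra.ι K (vert v) * FreeAlgebra.ι K (vert w)) 0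
  | src_edge (e : E) :
      LeavittRel (FreeAlgebra.ι K (vert (G.src e)) * FreeAlgebra.ι K (edge e))
        (FreeAlgebra.ι K (edge e))
  | edge_rng (e : E) :
      LeavittRel (FreeAlgebra.ι K (edge e) * FreeAlgebra.ι K (vert (G.rng e)))
        (FreeAlgebra.ι K (edge e))
  | rng_ghost (e : E) :
      LeavittRel (FreeAlgebra.ι K (vert (G.rng e)) * FreeAlgebra.ι K (ghost e))
        (FreeAlgebra.ι K (ghost e))
  | ghost_src (e : E) :
      LeavittRel (FreeAlgebra.ι K (ghost e) * FreeAlgebra.ι K (vert (G.src e)))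
        (FreeAlgebra.ι K (ghost e))
  | ghost_edge_self (e : E) :
      LeavittRel (FreeAlgebra.ι K (ghost e) * FreeAlgebra.ι K (edge e))
        (FreeAlgebra.ι K (vert (G.rng e)))
  | ghost_edge_ne (e f : E) (h : e ≠ f) :
      LeavittRel (FreeAlgebra.ι K (ghost e) * FreeAlgebra.ι K (edge f)) 0
  | sum_edge_ghost (v : V) (h : ∃ e, G.src e = v) :
      LeavittRel (∑ᶠ (e : E) (_ : G.src e = v),
        FreeAlgebra.ι K (edge e) * FreeAlgebra.ι K (ghost e)) (FreeAlgebra.ι K (vert v))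
  | sum_vert :
      LeavittRel (∑ᶠ v : V, FreeAlgebra.ι K (vert v)) 1

/-- The Leavitt path algebra `L_K(G)` of a finite graph `G`. -/
def LeavittPathAlgebra : Type _ := RingQuot (LeavittRel K G)

namespace LeavittPathAlgebra

noncomputable instance : Ring (LeavittPathAlgebra K G) :=
  inferInstanceAs (Ring (RingQuot (LeavittRel K G)))

noncomputable instance : Algebra K (LeavittPathAlgebra K G) :=
  inferInstanceAs (Algebra K (RingQuot (LeavittRel K G)))

/-- The image of a generator in `L_K(G)`. -/
noncomputable def gen (x : LeavittGen V E) : LeavittPathAlgebra K G :=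
  RingQuot.mkAlgHom K (LeavittRel K G) (FreeAlgebra.ι K x)

/-- The homogeneous component `L_K(G)_k`: the span of the words of total degree `k` in the
generators. -/
noncomputable def grading (k : ℤ) : Submodule K (LeavittPathAlgebra K G) :=
  Submodule.span K
    {x | ∃ w : List (LeavittGen V E), (w.map LeavittGen.deg).sum = k ∧ (w.map (gen K G)).prod = x}

end LeavittPathAlgebra

end Leavitt

/-! ### Gradings -/

/-- Graded isomorphism of `ℤ`-graded rings. -/
def GradedRingIso {A B σ τ : Type*} [Ring A] [Ring B] [SetLike σ A] [SetLike τ B]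
    (𝒜 : ℤ → σ) (ℬ : ℤ → τ) : Prop :=
  ∃ φ : A ≃+* B, ∀ k a, a ∈ 𝒜 k ↔ φ a ∈ ℬ k

/-- Graded isomorphism of `ℤ`-graded `K`-algebras. -/
def GradedAlgIso (K : Type*) [Field K] {A B σ τ : Type*} [Ring A] [Ring B] [Algebra K A]
    [Algebra K B] [SetLike σ A] [SetLike τ B] (𝒜 : ℤ → σ) (ℬ : ℤ → τ) : Prop :=
  ∃ φ : A ≃ₐ[K] B, ∀ k a, a ∈ 𝒜 k ↔ φ a ∈ ℬ k

/-- The grading of `A ⊗ B`: the component of degree `k` is spanned by the `a ⊗ b` with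
`a`, `b` homogeneous and `deg a + deg b = k`. -/
def tensorGrading {K : Type*} [Field K] {A B : Type*} [Ring A] [Ring B] [Algebra K A]
    [Algebra K B] (𝒜 : ℤ → Submodule K A) (ℬ : ℤ → Submodule K B) (k : ℤ) :
    Submodule K (TensorProduct K A B) :=
  Submodule.span K {x | ∃ i j : ℤ, i + j = k ∧ ∃ a ∈ 𝒜 i, ∃ b ∈ ℬ j, TensorProduct.tmul K a b = x}

/-- The grading of the group ring `A[ℤ]` of a graded ring `A`: the component of degree `k` is
the sum over `i + j = k` of the `A_i ⬝ j`, i.e. the coefficient at `j` lies in `A_{k - j}`. -/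
def groupRingGrading {A σ : Type*} [Ring A] [SetLike σ A] [AddSubgroupClass σ A]
    (𝒜 : ℤ → σ) (k : ℤ) : AddSubgroup (AddMonoidAlgebra A ℤ) where
  carrier := {f | ∀ j, f.coeff j ∈ 𝒜 (k - j)}
  zero_mem' j := zero_mem (𝒜 (k - j))
  add_mem' hf hg j := add_mem (hf j) (hg j)
  neg_mem' hf j := neg_mem (hf j)

/-- The grading of the direct sum (product) over `s` of the matrix algebras
`M_{n_s}(K)(δ_s)`, where `deg e_{pq} = δ_s p - δ_s q`. -/
def matrixGrading (K : Type*) [Field K] {ι : Type*} {n : ι → Type*} (δ : ∀ s, n s → ℤ) (k : ℤ) :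
    Submodule K (∀ s, Matrix (n s) (n s) K) where
  carrier := {M | ∀ s p q, M s p q ≠ 0 → δ s p - δ s q = k}
  zero_mem' s p q h := absurd rfl h
  add_mem' {M N} hM hN s p q h := by
    by_cases h0 : M s p q = 0
    · exact hN s p q fun h1 => h (by simp [h0, h1])
    · exact hM s p q h0
  smul_mem' c M hM s p q h := hM s p q fun h0 => h (by simp [h0])

namespace DirGraph.Polycephaly

variable {V E : Type*} {G : DirGraph V E} (P : G.Polycephaly) (K : Type*) [Field K]

/-- The algebra `⨁_s M_{n(v_s)}(K)`; the rows and columns of the `s`-th matrices are indexed by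
the `n(v_s)` paths of `E_1` with range `v_s`. -/
abbrev MatrixSum : Type _ :=
  ∀ s, Matrix (P.residual.PathInto (P.head s)) (P.residual.PathInto (P.head s)) K

/-- The grading of `⨁_s M_{n(v_s)}(K)(|p_1|, …, |p_{n(v_s)}|)`. -/
def matrixSumGrading : ℤ → Submodule K (P.MatrixSum K) :=
  matrixGrading K fun _ p => (p.edges.length : ℤ)

/-- Every cycle has length `1` and every rose has exactly one petal. -/
def AllHeadsAreLoops : Prop :=
  (∀ s, (P.cyc s).length = 1) ∧ ∀ s, P.numPetals s = 1

end DirGraph.Polycephaly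

/-!
Everything is expressed by families of elements that satisfy the defining relations of `L_K(E)`
(`IsLeavittFamily`), and rests on the fact that the vertices are nonzero
(`LeavittPathAlgebra.vert_ne_zero`).

The group ring `A[ℤ]` contains a central unit of degree `1`, namely `1 ∈ ℤ`. So if `L_K(E)` is
graded isomorphic to `A[ℤ]`, it has a central unit `z` of degree `1`. Let `v` be a sink or a vertex
on a closed path. For a closed path `q` at `v` that is long enough (or `q = v` if `v` is a sink),
all ghost edges in `z q` cancel, so that `z q` is a combination of paths of length `|q| + 1`; hence
`z v = q* q z = q* (z q)` is a combination of loops at `v`. It is not zero, so there is a loop, and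
comparing `z d` with `d z` for a second loop `d` shows that there is only one
(`LeavittPathAlgebra.existsUnique_loop_of_central_unit`). Applied to the vertices `v_s`, this says
that all cycles have length `1` and all roses have one petal.

In the acyclic graph `E_1` the sinks are exactly the `v_s`. For paths `p`, `q` into sinks,
`p* q = 0` unless `p = q`, and the sum of all `p p*` is `1`, because every vertex is the sum of the
`p p*` over the paths `p` that it emits (`DirGraph.Polycephaly.vert_eq_sum`). So the `p q*` are
matrix units in every algebra with a Leavitt family for `E_1`
(`DirGraph.Polycephaly.isMatrixFamily`), and `L_K(E_1)` is the sum of the matrix algebras.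

Suppose that all edges emitted by the `v_s` are loops, and that there are `n` of them at each `v_s`,
denoted by `α_{s,1}, …, α_{s,n}`. Then `x_i ↦ ∑ p α_{s,i} p*`, where `p` runs over all paths of
`E_1` into the `v_s`, defines a homomorphism `L_K(1, n) → L_K(E)` whose image commutes with the
matrix units `p q*`, that is, with `L_K(E_1)`. The resulting map
`L_K(E_1) ⊗ L_K(1, n) → L_K(E)` is inverse to the map which sends `α_{s,i}` to `v_s ⊗ x_i` and the
generators of `L_K(E_1)` to themselves (`DirGraph.Polycephaly.RoseHeads.gradedAlgIso_tensor`). As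
`L_K(1, 1)` is the ring of Laurent polynomials, the case `n = 1` gives the isomorphism with the
group ring of the sum of the matrix algebras.
-/

open LeavittGen
open scoped TensorProduct

/-! ### Universal property of Leavitt path algebras -/

section Projection

variable (K : Type*) [Field K] {V E : Type*} (G : DirGraph V E)

namespace LeavittPathAlgebra

/-- The projection from the free algebra. -/
noncomputable def proj : FreeAlgebra K (LeavittGen V E) →ₐ[K] LeavittPathAlgebra K G :=
  RingQuot.mkAlgHom K (LeavittRel K G)

variable {K G}

theorem proj_surjective : Function.Surjective (proj K G) :=
  RingQuot.mkAlgHom_surjective K (LeavittRel K G)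

theorem algHom_ext {B : Type*} [Ring B] [Algebra K B] {φ ψ : LeavittPathAlgebra K G →ₐ[K] B}
    (h : ∀ x, φ (gen K G x) = ψ (gen K G x)) : φ = ψ := by
  have : φ.comp (proj K G) = ψ.comp (proj K G) := FreeAlgebra.hom_ext (funext h)
  ext a
  obtain ⟨b, rfl⟩ := proj_surjective a
  exact DFunLike.congr_fun this b

end LeavittPathAlgebra

end Projection

section Families

variable {K : Type*} [Field K] {V E : Type*} [Fintype E] [DecidableEq V]

theorem finsum_src_eq {B : Type*} [Ring B] (G : DirGraph V E) (v : V) (g : E → B) :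
    (∑ᶠ (e : E) (_ : G.src e = v), g e) = ∑ e, if G.src e = v then g e else 0 := by
  rw [finsum_eq_sum_of_fintype]
  exact Finset.sum_congr rfl fun e _ => finsum_eq_if

variable [Fintype V]

/-- A family of elements of a ring, indexed by the generators of `L_K(G)`, which satisfies the
defining relations of `L_K(G)`. The sums are written as finite sums over all vertices and
edges. -/
structure IsLeavittFamily (G : DirGraph V E) {B : Type*} [Ring B]
    (f : LeavittGen V E → B) : Prop where
  vert_self : ∀ v, f (vert v) * f (vert v) = f (vert v)
  vert_ne : ∀ v w, v ≠ w → f (vert v) * f (vert w) = 0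
  src_edge : ∀ e, f (vert (G.src e)) * f (edge e) = f (edge e)
  edge_rng : ∀ e, f (edge e) * f (vert (G.rng e)) = f (edge e)
  rng_ghost : ∀ e, f (vert (G.rng e)) * f (ghost e) = f (ghost e)
  ghost_src : ∀ e, f (ghost e) * f (vert (G.src e)) = f (ghost e)
  ghost_edge_self : ∀ e, f (ghost e) * f (edge e) = f (vert (G.rng e))
  ghost_edge_ne : ∀ e e', e ≠ e' → f (ghost e) * f (edge e') = 0
  sum_edge_ghost : ∀ v, (∃ e, G.src e = v) →
    (∑ e, if G.src e = v then f (edge e) * f (ghost e) else 0) = f (vert v)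
  sum_vert : ∑ v, f (vert v) = 1

namespace LeavittPathAlgebra

variable (K) (G : DirGraph V E)

theorem isLeavittFamily_gen : IsLeavittFamily G (gen K G) := by
  have key : ∀ {x y}, LeavittRel K G x y → proj K G x = proj K G y :=
    fun h => RingQuot.mkAlgHom_rel K h
  have mul : ∀ x y, gen K G x * gen K G y
      = proj K G (FreeAlgebra.ι K x * FreeAlgebra.ι K y) := fun x y => (map_mul _ _ _).symm
  constructor
  · exact fun v => (mul _ _).trans (key (.vert_self v))
  · exact fun v w h => (mul _ _).trans ((key (.vert_ne v w h)).trans (map_zero _))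
  · exact fun e => (mul _ _).trans (key (.src_edge e))
  · exact fun e => (mul _ _).trans (key (.edge_rng e))
  · exact fun e => (mul _ _).trans (key (.rng_ghost e))
  · exact fun e => (mul _ _).trans (key (.ghost_src e))
  · exact fun e => (mul _ _).trans (key (.ghost_edge_self e))
  · exact fun e f h => (mul _ _).trans ((key (.ghost_edge_ne e f h)).trans (map_zero _))
  · intro v h
    have := key (.sum_edge_ghost v h)
    rw [finsum_src_eq, map_sum] at this
    refine Eq.trans (Finset.sum_congr rfl fun e _ => ?_) this
    split_ifs
    · exact mul _ _
    · exact (map_zero _).symm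
  · have := key .sum_vert
    rw [finsum_eq_sum_of_fintype, map_sum, map_one] at this
    exact this

theorem gen_rose_vert (n : ℕ) (v : Unit) : gen K (DirGraph.rose n) (vert v) = 1 := by
  simpa using (isLeavittFamily_gen K (DirGraph.rose n)).sum_vert

variable {K G}

/-- The universal property of `L_K(G)`. -/
noncomputable def lift {B : Type*} [Ring B] [Algebra K B] {f : LeavittGen V E → B}
    (hf : IsLeavittFamily G f) : LeavittPathAlgebra K G →ₐ[K] B :=
  RingQuot.liftAlgHom K ⟨FreeAlgebra.lift K f, by
    intro x y h
    cases h with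
    | vert_self v => simpa using hf.vert_self v
    | vert_ne v w h => simpa using hf.vert_ne v w h
    | src_edge e => simpa using hf.src_edge e
    | edge_rng e => simpa using hf.edge_rng e
    | rng_ghost e => simpa using hf.rng_ghost e
    | ghost_src e => simpa using hf.ghost_src e
    | ghost_edge_self e => simpa using hf.ghost_edge_self e
    | ghost_edge_ne e f h => simpa using hf.ghost_edge_ne e f h
    | sum_edge_ghost v h =>
      rw [finsum_src_eq, map_sum, FreeAlgebra.lift_ι_apply, ← hf.sum_edge_ghost v h]
      refine Finset.sum_congr rfl fun e _ => ?_
      split_ifs <;> simp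
    | sum_vert =>
      rw [finsum_eq_sum_of_fintype, map_sum, map_one, ← hf.sum_vert]
      simp⟩

@[simp]
theorem lift_gen {B : Type*} [Ring B] [Algebra K B] {f : LeavittGen V E → B}
    (hf : IsLeavittFamily G f) (x : LeavittGen V E) : lift (K := K) hf (gen K G x) = f x := by
  unfold lift gen
  exact (RingQuot.liftAlgHom_mkAlgHom_apply K _ _ _).trans (FreeAlgebra.lift_ι_apply _ _)

end LeavittPathAlgebra

end Families

/-! ### Gradings and nonvanishing of vertices -/

section Gradings

theorem GradedAlgIso.of_algEquiv {K : Type*} [Field K] {A B σ τ : Type*} [Ring A] [Ring B]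
    [Algebra K A] [Algebra K B] [SetLike σ A] [SetLike τ B] {𝒜 : ℤ → σ} {ℬ : ℤ → τ}
    (φ : A ≃ₐ[K] B) (h : ∀ k, ∀ a ∈ 𝒜 k, φ a ∈ ℬ k) (h' : ∀ k, ∀ b ∈ ℬ k, φ.symm b ∈ 𝒜 k) :
    GradedAlgIso K 𝒜 ℬ :=
  ⟨φ, fun k a => ⟨h k a, fun ha => by simpa using h' k _ ha⟩⟩

theorem GradedAlgIso.trans {K : Type*} [Field K] {A B C σ τ υ : Type*} [Ring A] [Ring B] [Ring C]
    [Algebra K A] [Algebra K B] [Algebra K C] [SetLike σ A] [SetLike τ B] [SetLike υ C]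
    {𝒜 : ℤ → σ} {ℬ : ℤ → τ} {𝒞 : ℤ → υ} (h : GradedAlgIso K 𝒜 ℬ) (h' : GradedAlgIso K ℬ 𝒞) :
    GradedAlgIso K 𝒜 𝒞 :=
  let ⟨φ, hφ⟩ := h
  let ⟨ψ, hψ⟩ := h'
  ⟨φ.trans ψ, fun k a => (hφ k a).trans (hψ k _)⟩

theorem GradedAlgIso.gradedRingIso {K : Type*} [Field K] {A B σ τ : Type*} [Ring A] [Ring B]
    [Algebra K A] [Algebra K B] [SetLike σ A] [SetLike τ B] {𝒜 : ℤ → σ} {ℬ : ℤ → τ}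
    (h : GradedAlgIso K 𝒜 ℬ) : GradedRingIso 𝒜 ℬ :=
  let ⟨φ, hφ⟩ := h
  ⟨φ.toRingEquiv, hφ⟩

namespace LeavittPathAlgebra

variable {K : Type*} [Field K] {V E : Type*} {G : DirGraph V E}

theorem gen_mem_grading (x : LeavittGen V E) : gen K G x ∈ grading K G x.deg :=
  Submodule.subset_span ⟨[x], by simp, by simp⟩

instance : SetLike.GradedMonoid (grading K G) where
  one_mem := Submodule.subset_span ⟨[], by simp, by simp⟩
  mul_mem i j a b ha hb := by
    refine Submodule.span_induction₂ (p := fun a b _ _ => a * b ∈ grading K G (i + j))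
      ?_ ?_ ?_ ?_ ?_ ?_ ?_ ha hb
    · rintro _ _ ⟨w, rfl, rfl⟩ ⟨w', rfl, rfl⟩
      exact Submodule.subset_span ⟨w ++ w', by simp, by simp⟩
    · intros; simp
    · intros; simp
    · intro x y z _ _ _ h h'; rw [add_mul]; exact add_mem h h'
    · intro x y z _ _ _ h h'; rw [mul_add]; exact add_mem h h'
    · intro r x y _ _ h; rw [smul_mul_assoc]; exact Submodule.smul_mem _ _ h
    · intro r x y _ _ h; rw [mul_smul_comm]; exact Submodule.smul_mem _ _ h

/-- A homomorphism of algebras from a Leavitt path algebra is graded as soon as it respects the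
degrees of the generators. -/
theorem map_mem_of_gen {B τ : Type*} [Ring B] [Algebra K B] [SetLike τ B] [AddSubgroupClass τ B]
    {ℬ : ℤ → τ} [SetLike.GradedMonoid ℬ] (hsmul : ∀ k (c : K), ∀ b ∈ ℬ k, c • b ∈ ℬ k)
    (φ : LeavittPathAlgebra K G →ₐ[K] B) (h : ∀ x, φ (gen K G x) ∈ ℬ x.deg) {k : ℤ}
    {a : LeavittPathAlgebra K G} (ha : a ∈ grading K G k) : φ a ∈ ℬ k := by
  refine Submodule.span_induction ?_ (by rw [map_zero]; exact zero_mem _)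
    (fun x y _ _ hx hy => by rw [map_add]; exact add_mem hx hy)
    (fun c x _ hx => by rw [map_smul]; exact hsmul _ _ _ hx) ha
  rintro _ ⟨w, rfl, rfl⟩
  clear ha
  induction w with
  | nil => simpa using SetLike.GradedOne.one_mem
  | cons x w ih => simpa using SetLike.GradedMul.mul_mem (h x) ih

end LeavittPathAlgebra

end Gradings

section Nonzero

variable {V E : Type*} [Fintype V] [Fintype E] [DecidableEq V]

/-- Vertices are nonzero in `L_K(G)`: the algebra acts on the functions on `V × ℕ`, where `v` acts
as the projection to the functions supported on `{v} × ℕ`, and, for each vertex `v` that is not a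
sink, the edges with source `v` act through a bijection from `{v} × ℕ` to the disjoint union of the
`{r(e)} × ℕ` over these edges. -/
theorem LeavittPathAlgebra.vert_ne_zero (K : Type*) [Field K] (G : DirGraph V E) (v : V) :
    gen K G (vert v) ≠ 0 := by
  classical
  have hβ : ∀ v, (∃ e, G.src e = v) → Nonempty (ℕ ≃ {e // G.src e = v} × ℕ) := by
    rintro v ⟨e, he⟩
    have : Nonempty {e // G.src e = v} := ⟨⟨e, he⟩⟩
    exact nonempty_equiv_of_countable
  obtain ⟨β⟩ : Nonempty (∀ v, (∃ e, G.src e = v) → (ℕ ≃ {e // G.src e = v} × ℕ)) :=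
    ⟨fun v h => (hβ v h).some⟩
  let opV (v : V) : Module.End K (V × ℕ → K) :=
    { toFun := fun F x => if x.1 = v then F x else 0
      map_add' := fun F F' => by ext x; by_cases h : x.1 = v <;> simp [h]
      map_smul' := fun c F => by ext x; by_cases h : x.1 = v <;> simp [h] }
  let opE (e : E) : Module.End K (V × ℕ → K) :=
    { toFun := fun F x => if G.src e = x.1 ∧ ((β (G.src e) ⟨e, rfl⟩ x.2).1 : E) = e then
        F (G.rng e, (β (G.src e) ⟨e, rfl⟩ x.2).2) else 0
      map_add' := fun F F' => by ext x; dsimp only [Pi.add_apply]; split_ifs <;> simp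
      map_smul' := fun c F => by
        ext x; dsimp only [Pi.smul_apply, RingHom.id_apply]; split_ifs <;> simp }
  let opG (e : E) : Module.End K (V × ℕ → K) :=
    { toFun := fun F x => if x.1 = G.rng e then
        F (G.src e, (β (G.src e) ⟨e, rfl⟩).symm (⟨e, rfl⟩, x.2)) else 0
      map_add' := fun F F' => by ext x; dsimp only [Pi.add_apply]; split_ifs <;> simp
      map_smul' := fun c F => by
        ext x; dsimp only [Pi.smul_apply, RingHom.id_apply]; split_ifs <;> simp }
  let f : LeavittGen V E → Module.End K (V × ℕ → K)
    | vert v => opV v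
    | edge e => opE e
    | ghost e => opG e
  have hf : IsLeavittFamily G f := by
    constructor
    · intro v
      ext F x; by_cases h : x.1 = v <;> simp [f, opV, h]
    · intro v w hvw
      ext F x
      simp only [f, opV, Module.End.mul_apply, LinearMap.coe_mk, AddHom.coe_mk]
      split_ifs with h h'
      · exact absurd (h.symm.trans h') hvw
      all_goals rfl
    · intro e
      ext F x
      simp only [f, opV, opE, Module.End.mul_apply, LinearMap.coe_mk, AddHom.coe_mk]
      split_ifs with h h' h' <;> first | rfl | exact absurd h'.1.symm h
    · intro e
      ext F x
      simp [f, opV, opE]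
    · intro e
      ext F x
      simp only [f, opV, opG, Module.End.mul_apply, LinearMap.coe_mk, AddHom.coe_mk]
      split_ifs <;> rfl
    · intro e
      ext F x
      simp [f, opV, opG]
    · intro e
      ext F x
      by_cases h : x.1 = G.rng e
      · simp [f, opV, opE, opG, ← h]
      · simp [f, opV, opE, opG, h]
    · intro e e' hee'
      ext F x
      simp only [f, opE, opG, Module.End.mul_apply, LinearMap.coe_mk, AddHom.coe_mk]
      split_ifs with h h'
      · obtain ⟨h1, h2⟩ := h'
        exfalso
        have key : ∀ (v : V) (h : ∃ e, G.src e = v) (hv : v = G.src e),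
            ((β v h ((β (G.src e) ⟨e, rfl⟩).symm (⟨e, rfl⟩, x.2))).1 : E) = e := by
          rintro v h rfl; simp
        exact hee' ((key _ _ h1).symm.trans h2)
      all_goals rfl
    · rintro v ⟨e₀, he₀⟩
      ext F x
      have key : ∀ e, (if G.src e = v then f (edge e) * f (ghost e) else 0) F x
          = if e = ((β v ⟨e₀, he₀⟩ x.2).1 : E) then (if x.1 = v then F x else 0) else 0 := by
        intro e
        by_cases hs : G.src e = v
        · subst hs
          simp only [if_true, f, opE, opG, Module.End.mul_apply, LinearMap.coe_mk, AddHom.coe_mk]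
          obtain ⟨w, n⟩ := x
          by_cases h : G.src e = w
          · subst h
            by_cases h' : ((β (G.src e) ⟨e, rfl⟩ n).1 : E) = e
            · have h2 : (⟨e, rfl⟩, (β (G.src e) ⟨e, rfl⟩ n).2) = β (G.src e) ⟨e, rfl⟩ n :=
                Prod.ext (Subtype.ext h'.symm) rfl
              simp [h', h2]
            · simp [h', Ne.symm h']
          · simp [h, Ne.symm h]
        · have : e ≠ ((β v ⟨e₀, he₀⟩ x.2).1 : E) := fun h =>
            hs (h ▸ (β v ⟨e₀, he₀⟩ x.2).1.2)
          simp [hs, this]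
      rw [LinearMap.sum_apply, Finset.sum_apply, Finset.sum_congr rfl fun e _ => key e]
      simp [f, opV]
    · ext F x
      rw [LinearMap.sum_apply, Finset.sum_apply]
      simp [f, opV]
  intro h
  have h1 := lift_gen (K := K) hf (vert v)
  rw [h, map_zero] at h1
  have h2 : (0 : Module.End K (V × ℕ → K)) (fun _ => 1) (v, 0) = opV v (fun _ => 1) (v, 0) := by
    rw [h1]
  simp [opV] at h2

end Nonzero

/-! ### Paths and central units of degree one -/

namespace DirGraph

section Paths

variable {V E : Type*} {G : DirGraph V E}

theorem IsPath.append {p q : List E} {u v w : V} (hp : G.IsPath u p v) (hq : G.IsPath v q w) :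
    G.IsPath u (p ++ q) w := by
  induction p generalizing u with
  | nil => exact (show u = v from hp) ▸ hq
  | cons e p ih => exact ⟨hp.1, ih hp.2⟩

theorem IsPath.exists_closed_length_ge {q : List E} {v : V} (h : G.IsPath v q v) (hq : q ≠ [])
    (n : ℕ) : ∃ q', G.IsPath v q' v ∧ n ≤ q'.length := by
  induction n with
  | zero => exact ⟨q, h, Nat.zero_le _⟩
  | succ n ih =>
    obtain ⟨q', h', hn⟩ := ih
    have := List.length_pos_iff.2 hq
    exact ⟨q ++ q', h.append h', by rw [List.length_append]; omega⟩

variable {B : Type*} [Ring B]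

variable (G) in
/-- The product of the edges of a path `p` with source `v`, in an algebra with a family `f` of
elements indexed by the generators; the trivial path at `v` gives the vertex `v`. -/
def pathElt (f : LeavittGen V E → B) : V → List E → B
  | v, [] => f (vert v)
  | _, e :: p => f (edge e) * pathElt f (G.rng e) p

variable (G) in
/-- The product `p*` of the ghost edges of a path `p` with source `v`, in reverse order. -/
def ghostElt (f : LeavittGen V E → B) : V → List E → B
  | v, [] => f (vert v)
  | _, e :: p => ghostElt f (G.rng e) p * f (ghost e)

theorem map_pathElt {C F : Type*} [Ring C] [FunLike F B C] [RingHomClass F B C] (φ : F)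
    (f : LeavittGen V E → B) (v : V) (p : List E) :
    φ (G.pathElt f v p) = G.pathElt (fun x => φ (f x)) v p := by
  induction p generalizing v with
  | nil => rfl
  | cons e p ih => rw [pathElt, map_mul, ih, pathElt]

theorem map_ghostElt {C F : Type*} [Ring C] [FunLike F B C] [RingHomClass F B C] (φ : F)
    (f : LeavittGen V E → B) (v : V) (p : List E) :
    φ (G.ghostElt f v p) = G.ghostElt (fun x => φ (f x)) v p := by
  induction p generalizing v with
  | nil => rfl
  | cons e p ih => rw [ghostElt, map_mul, ih, ghostElt]

end Paths

end DirGraph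

namespace IsLeavittFamily

open DirGraph

variable {V E : Type*} [Fintype E] [Fintype V] [DecidableEq V] {G : DirGraph V E}
  {B : Type*} [Ring B] {f : LeavittGen V E → B} (hf : IsLeavittFamily G f)

include hf

theorem vert_mul_edge_of_ne {v : V} {e : E} (h : v ≠ G.src e) :
    f (vert v) * f (edge e) = 0 := by
  rw [← hf.src_edge, ← mul_assoc, hf.vert_ne _ _ h, zero_mul]

theorem edge_mul_vert_of_ne {v : V} {e : E} (h : G.rng e ≠ v) :
    f (edge e) * f (vert v) = 0 := by
  rw [← hf.edge_rng, mul_assoc, hf.vert_ne _ _ h, mul_zero]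

theorem ghost_mul_vert_of_ne {v : V} {e : E} (h : G.src e ≠ v) :
    f (ghost e) * f (vert v) = 0 := by
  rw [← hf.ghost_src, mul_assoc, hf.vert_ne _ _ h, mul_zero]

variable {u v w : V} {p q : List E}

theorem vert_mul_pathElt (h : G.IsPath v p w) :
    f (vert v) * G.pathElt f v p = G.pathElt f v p := by
  cases p with
  | nil => exact hf.vert_self v
  | cons e p => obtain ⟨rfl, -⟩ := h; rw [pathElt, ← mul_assoc, hf.src_edge]

theorem vert_mul_pathElt_of_ne (h : G.IsPath v p w) (hu : u ≠ v) :
    f (vert u) * G.pathElt f v p = 0 := by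
  rw [← hf.vert_mul_pathElt h, ← mul_assoc, hf.vert_ne _ _ hu, zero_mul]

theorem pathElt_mul_vert (h : G.IsPath v p w) :
    G.pathElt f v p * f (vert w) = G.pathElt f v p := by
  induction p generalizing v with
  | nil => obtain rfl : v = w := h; exact hf.vert_self v
  | cons e p ih => rw [pathElt, mul_assoc, ih h.2]

theorem ghostElt_mul_vert (h : G.IsPath v p w) :
    G.ghostElt f v p * f (vert v) = G.ghostElt f v p := by
  cases p with
  | nil => exact hf.vert_self v
  | cons e p => obtain ⟨rfl, -⟩ := h; rw [ghostElt, mul_assoc, hf.ghost_src]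

theorem ghostElt_mul_vert_of_ne (h : G.IsPath v p w) (hu : v ≠ u) :
    G.ghostElt f v p * f (vert u) = 0 := by
  rw [← hf.ghostElt_mul_vert h, mul_assoc, hf.vert_ne _ _ hu, mul_zero]

theorem vert_mul_ghostElt (h : G.IsPath v p w) :
    f (vert w) * G.ghostElt f v p = G.ghostElt f v p := by
  induction p generalizing v with
  | nil => obtain rfl : v = w := h; exact hf.vert_self v
  | cons e p ih => rw [ghostElt, ← mul_assoc, ih h.2]

theorem ghostElt_mul_pathElt_self (h : G.IsPath v p w) :
    G.ghostElt f v p * G.pathElt f v p = f (vert w) := by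
  induction p generalizing v with
  | nil => obtain rfl : v = w := h; exact hf.vert_self v
  | cons e p ih =>
    rw [ghostElt, pathElt, mul_assoc, ← mul_assoc (f (ghost e)), hf.ghost_edge_self,
      hf.vert_mul_pathElt h.2, ih h.2]

/-- For `|p| = |q| + 1`, either `q` is not a prefix of `p` and `q* p = 0`, or `p = q e` for an edge
`e` and `q* p = e`. -/
theorem ghostElt_mul_pathElt_of_length_eq_add_one {v' w' : V} (hq : G.IsPath v q v')
    (hp : G.IsPath u p w') (hl : p.length = q.length + 1) :
    G.ghostElt f v q * G.pathElt f u p = 0 ∨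
      ∃ e, G.src e = v' ∧ G.rng e = w' ∧ G.ghostElt f v q * G.pathElt f u p = f (edge e) := by
  classical
  induction q generalizing u v p with
  | nil =>
    obtain ⟨e, rfl⟩ := List.length_eq_one_iff.1 hl
    obtain rfl : v = v' := hq
    obtain ⟨rfl, h⟩ := hp
    by_cases hv : v = G.src e
    · subst hv
      refine Or.inr ⟨e, rfl, h, ?_⟩
      rw [ghostElt, pathElt, pathElt, hf.edge_rng, hf.src_edge]
    · left
      rw [ghostElt, pathElt, ← mul_assoc, hf.vert_mul_edge_of_ne hv, zero_mul]
  | cons d q ih =>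
    obtain ⟨e, p, rfl⟩ := List.exists_cons_of_length_eq_add_one hl
    obtain ⟨rfl, hp⟩ := hp
    by_cases hde : d = e
    · subst hde
      rw [ghostElt, pathElt, mul_assoc, ← mul_assoc (f (ghost d)), hf.ghost_edge_self,
        hf.vert_mul_pathElt hp]
      exact ih hq.2 hp (by simpa using hl)
    · left
      rw [ghostElt, pathElt, mul_assoc, ← mul_assoc (f (ghost d)), hf.ghost_edge_ne _ _ hde,
        zero_mul, mul_zero]

end IsLeavittFamily

namespace LeavittPathAlgebra

open DirGraph

variable {K : Type*} [Field K] {V E : Type*} [Fintype V] [Fintype E] [DecidableEq V]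
  {G : DirGraph V E}

variable (K G) in
/-- The span in `L_K(G)` of the paths of length `k` with range `w`. -/
noncomputable def pathSpan (w : V) (k : ℤ) : Submodule K (LeavittPathAlgebra K G) :=
  Submodule.span K {x | ∃ u p, G.IsPath u p w ∧ (p.length : ℤ) = k ∧ G.pathElt (gen K G) u p = x}

theorem gen_mul_pathElt_mem (x : LeavittGen V E) {u w : V} {p : List E} (hp : G.IsPath u p w)
    (h : 1 ≤ p.length ∨ ∀ e, G.src e ≠ w) :
    gen K G x * G.pathElt (gen K G) u p ∈ pathSpan K G w (p.length + x.deg) := by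
  classical
  have hf := isLeavittFamily_gen K G
  cases x with
  | vert v =>
    by_cases hv : v = u
    · subst hv
      rw [hf.vert_mul_pathElt hp]
      exact Submodule.subset_span ⟨v, p, hp, by simp [deg], rfl⟩
    · rw [hf.vert_mul_pathElt_of_ne hp hv]
      exact zero_mem _
  | edge e =>
    by_cases hv : G.rng e = u
    · subst hv
      exact Submodule.subset_span ⟨G.src e, e :: p, ⟨rfl, hp⟩, by simp [deg], rfl⟩
    · rw [← hf.vert_mul_pathElt hp, ← mul_assoc, hf.edge_mul_vert_of_ne hv, zero_mul]
      exact zero_mem _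
  | ghost e =>
    cases p with
    | nil =>
      obtain rfl : u = w := hp
      rw [pathElt, hf.ghost_mul_vert_of_ne (h.resolve_left (by simp) e)]
      exact zero_mem _
    | cons d p =>
      rw [pathElt, ← mul_assoc]
      by_cases hed : e = d
      · subst hed
        rw [hf.ghost_edge_self, hf.vert_mul_pathElt hp.2]
        exact Submodule.subset_span ⟨_, p, hp.2, by simp [deg], rfl⟩
      · rw [hf.ghost_edge_ne _ _ hed, zero_mul]
        exact zero_mem _

/-- Multiplication by a fixed element `a` of degree `d` takes all sufficiently long paths with
range `w` to linear combinations of paths, since each ghost edge occurring in `a` is cancelled. If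
`w` is a sink, then this holds for all paths with range `w`. -/
theorem exists_mul_pathElt_mem {d : ℤ} {a : LeavittPathAlgebra K G} (ha : a ∈ grading K G d)
    (w : V) : ∃ m : ℤ, ∀ v q, G.IsPath v q w → (m ≤ q.length ∨ ∀ e, G.src e ≠ w) →
      a * G.pathElt (gen K G) v q ∈ pathSpan K G w (q.length + d) := by
  refine Submodule.span_induction ?_ ⟨0, fun v q _ _ => by rw [zero_mul]; exact zero_mem _⟩
    ?_ ?_ ha
  · rintro _ ⟨l, rfl, rfl⟩
    clear ha
    induction l with
    | nil =>
      refine ⟨0, fun v q hq _ => ?_⟩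
      simp only [List.map_nil, List.prod_nil, List.sum_nil, one_mul, add_zero]
      exact Submodule.subset_span ⟨v, q, hq, rfl, rfl⟩
    | cons x l ih =>
      obtain ⟨m, hm⟩ := ih
      refine ⟨max m (1 - (l.map deg).sum), fun v q hq h => ?_⟩
      have h1 := hm v q hq (h.imp_left fun h => (le_max_left _ _).trans h)
      rw [List.map_cons, List.map_cons, List.prod_cons, List.sum_cons, mul_assoc,
        add_comm x.deg, ← add_assoc]
      refine Submodule.span_induction (p := fun b _ => gen K G x * b ∈
        pathSpan K G w (q.length + (l.map deg).sum + x.deg)) ?_ (by rw [mul_zero]; exact zero_mem _)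
        (fun b c _ _ hb hc => by rw [mul_add]; exact add_mem hb hc)
        (fun r b _ hb => by rw [mul_smul_comm]; exact Submodule.smul_mem _ _ hb) h1
      rintro _ ⟨u, p, hp, hl, rfl⟩
      rw [← hl]
      refine gen_mul_pathElt_mem x hp (h.imp_left fun h => ?_)
      have := (le_max_right _ _).trans h
      omega
  · rintro a b _ _ ⟨m, hm⟩ ⟨n, hn⟩
    refine ⟨max m n, fun v q hq h => ?_⟩
    rw [add_mul]
    exact add_mem (hm v q hq (h.imp_left fun h => (le_max_left _ _).trans h))
      (hn v q hq (h.imp_left fun h => (le_max_right _ _).trans h))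
  · rintro c a _ ⟨m, hm⟩
    refine ⟨m, fun v q hq h => ?_⟩
    rw [smul_mul_assoc]
    exact Submodule.smul_mem _ _ (hm v q hq h)

/-- If `v` is a sink or lies on a closed path, then a central element of degree `1` acts on `v` as a
linear combination of the loops at `v`. -/
theorem central_mul_vert_eq_sum [DecidableEq E] {z : LeavittPathAlgebra K G}
    (hz : z ∈ grading K G 1) (hc : ∀ a, z * a = a * z) {v : V}
    (hv : (∀ e, G.src e ≠ v) ∨ ∃ q, q ≠ [] ∧ G.IsPath v q v) :
    ∃ c : E → K, z * gen K G (vert v) =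
      ∑ e, if G.src e = v ∧ G.rng e = v then c e • gen K G (edge e) else 0 := by
  have hf := isLeavittFamily_gen K G
  obtain ⟨m, hm⟩ := exists_mul_pathElt_mem hz v
  obtain ⟨q, hq, h⟩ : ∃ q, G.IsPath v q v ∧ (m ≤ q.length ∨ ∀ e, G.src e ≠ v) := by
    rcases hv with hv | ⟨q, hq, hq'⟩
    · exact ⟨[], rfl, Or.inr hv⟩
    · obtain ⟨q', h1, h2⟩ := hq'.exists_closed_length_ge hq m.toNat
      exact ⟨q', h1, Or.inl (by omega)⟩
  rw [← hf.ghostElt_mul_pathElt_self hq, hc, mul_assoc, ← hc]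
  refine Submodule.span_induction (p := fun b _ => ∃ c : E → K, G.ghostElt (gen K G) v q * b =
      ∑ e, if G.src e = v ∧ G.rng e = v then c e • gen K G (edge e) else 0) ?_
    ⟨0, by simp⟩ ?_ ?_ (hm v q hq h)
  · rintro _ ⟨u, p, hp, hl, rfl⟩
    rcases hf.ghostElt_mul_pathElt_of_length_eq_add_one hq hp (by omega) with h0 | ⟨e, h1, h2, h3⟩
    · exact ⟨0, by simp [h0]⟩
    · refine ⟨Pi.single e 1, ?_⟩
      rw [h3, Finset.sum_eq_single e]
      · simp [h1, h2]
      · intro d _ hd; simp [hd]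
      · simp
  · rintro a b _ _ ⟨c, hc⟩ ⟨d, hd⟩
    refine ⟨c + d, ?_⟩
    rw [mul_add, hc, hd, ← Finset.sum_add_distrib]
    refine Finset.sum_congr rfl fun e _ => ?_
    split_ifs <;> simp [add_smul]
  · rintro r a _ ⟨c, hc⟩
    refine ⟨r • c, ?_⟩
    rw [mul_smul_comm, hc, Finset.smul_sum]
    refine Finset.sum_congr rfl fun e _ => ?_
    split_ifs <;> simp [mul_smul]

/-- If `L_K(G)` has a central unit of degree `1`, then each vertex that is a sink or lies on a closed
path has exactly one loop; in particular it is not a sink. -/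
theorem existsUnique_loop_of_central_unit {z : LeavittPathAlgebra K G} (hz : z ∈ grading K G 1)
    (hc : ∀ a, z * a = a * z) (hu : IsUnit z) {v : V}
    (hv : (∀ e, G.src e ≠ v) ∨ ∃ q, q ≠ [] ∧ G.IsPath v q v) :
    ∃! e, G.src e = v ∧ G.rng e = v := by
  classical
  have hf := isLeavittFamily_gen K G
  have hzv : z * gen K G (vert v) ≠ 0 := fun h => vert_ne_zero K G v (hu.mul_right_eq_zero.1 h)
  obtain ⟨c, hcv⟩ := central_mul_vert_eq_sum hz hc hv
  rw [hcv] at hzv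
  obtain ⟨e, -, he⟩ := Finset.exists_ne_zero_of_sum_ne_zero hzv
  have hev : G.src e = v ∧ G.rng e = v := by by_contra h; simp [h] at he
  refine ⟨e, hev, fun d hd => ?_⟩
  by_contra hde
  rw [if_pos hev] at he
  -- As `z` commutes with `d`, the coefficient of `e` in `z v` is seen in `e* z d = e* d z = 0`.
  have h1 : gen K G (ghost e) * (z * gen K G (vert v)) * gen K G (edge d) = 0 := by
    rw [mul_assoc, mul_assoc, ← hd.1, hf.src_edge, hc, ← mul_assoc,
      hf.ghost_edge_ne _ _ (Ne.symm hde), zero_mul]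
  rw [hcv, Finset.mul_sum, Finset.sum_eq_single e, if_pos hev, mul_smul_comm, hf.ghost_edge_self,
    hev.2, smul_mul_assoc, ← hd.1, hf.src_edge] at h1
  · rcases smul_eq_zero.1 h1 with h2 | h2
    · simp [h2] at he
    · apply vert_ne_zero K G (G.rng d)
      rw [← hf.ghost_edge_self, h2, mul_zero]
  · intro b _ hb
    split_ifs
    · rw [mul_smul_comm, hf.ghost_edge_ne _ _ (Ne.symm hb), smul_zero]
    · rw [mul_zero]
  · simp

end LeavittPathAlgebra

namespace DirGraph.Polycephaly

variable {V E : Type*} {G : DirGraph V E} (P : G.Polycephaly)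

/-- By the absence of exits, a loop at a vertex of a cycle is the first and only edge of the cycle. -/
theorem allHeadsAreLoops_of_existsUnique_loop
    (h : ∀ v, ((∀ e, G.src e ≠ v) ∨ ∃ q, q ≠ [] ∧ G.IsPath v q v) →
      ∃! e, G.src e = v ∧ G.rng e = v) : P.AllHeadsAreLoops := by
  refine ⟨fun s => ?_, fun s => ?_⟩
  · obtain ⟨hne, hp, hnd⟩ := P.isCycle s
    obtain ⟨e, ⟨he, he'⟩, -⟩ := h (P.cycVertex s) (Or.inr ⟨P.cyc s, hne, hp⟩)
    have hno := P.cyc_no_exit s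
    generalize P.cyc s = C at hne hp hnd hno
    cases C with
    | nil => exact absurd rfl hne
    | cons c C =>
      have hec : e = c := List.inj_on_of_nodup_map hnd (hno c (by simp) e (he.trans hp.1.symm))
        (by simp) (he.trans hp.1.symm)
      subst hec
      cases C with
      | nil => rfl
      | cons d C =>
        simp only [List.map_cons, List.nodup_cons, List.mem_cons, not_or] at hnd
        exact absurd (hp.2.1.trans (he'.trans he.symm)).symm hnd.1.1
  · have hv : (∀ e, G.src e ≠ P.roseVertex s) ∨
        ∃ q, q ≠ [] ∧ G.IsPath (P.roseVertex s) q (P.roseVertex s) := by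
      by_cases hs : ∃ e, G.src e = P.roseVertex s
      · obtain ⟨e, he⟩ := hs
        exact Or.inr ⟨[e], by simp, he, P.rose_no_exit s e he⟩
      · exact Or.inl (not_exists.1 hs)
    obtain ⟨e, he, hu⟩ := h _ hv
    rw [numPetals, Nat.card_eq_one_iff_unique]
    exact ⟨⟨fun a b => Subtype.ext ((hu _ ⟨a.2, P.rose_no_exit s _ a.2⟩).trans
      (hu _ ⟨b.2, P.rose_no_exit s _ b.2⟩).symm)⟩, ⟨⟨e, he.1⟩⟩⟩

variable [Fintype V] [Fintype E] [DecidableEq V]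

/-- The element `1 ∈ ℤ` of the group ring `A[ℤ]` is a central unit of degree `1`. -/
theorem allHeadsAreLoops_of_gradedRingIso (K : Type*) [Field K] {A σ : Type*} [Ring A] [SetLike σ A]
    [AddSubgroupClass σ A] (𝒜 : ℤ → σ) (h1 : (1 : A) ∈ 𝒜 0)
    (h : GradedRingIso (LeavittPathAlgebra.grading K G) (groupRingGrading 𝒜)) :
    P.AllHeadsAreLoops := by
  obtain ⟨φ, hφ⟩ := h
  refine P.allHeadsAreLoops_of_existsUnique_loop fun v hv =>
    LeavittPathAlgebra.existsUnique_loop_of_central_unit (K := K)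
      (z := φ.symm (AddMonoidAlgebra.single 1 1)) ?_ ?_ ?_ hv
  · rw [hφ, φ.apply_symm_apply]
    intro j
    rw [AddMonoidAlgebra.coeff_single]
    rcases eq_or_ne j 1 with rfl | hj
    · simpa using h1
    · rw [Finsupp.single_eq_of_ne hj]
      exact zero_mem _
  · intro a
    apply φ.injective
    rw [map_mul, map_mul, φ.apply_symm_apply]
    generalize φ a = b
    induction b using AddMonoidAlgebra.induction_linear with
    | zero => simp
    | add x y hx hy => rw [mul_add, add_mul, hx, hy]
    | single n r =>
      rw [AddMonoidAlgebra.single_mul_single, AddMonoidAlgebra.single_mul_single, add_comm,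
        one_mul, mul_one]
  · refine IsUnit.map φ.symm ⟨⟨.single 1 1, .single (-1) 1, ?_, ?_⟩, rfl⟩ <;>
    · rw [AddMonoidAlgebra.single_mul_single]; simp

end DirGraph.Polycephaly

/-! ### The algebra of the acyclic graph as a sum of matrix algebras -/

section MatrixUnits

/-- Elements `u x`, `u' x` of a ring, indexed by the disjoint union of finite sets `n s`, such that
the products `u ⟨s, p⟩ * u' ⟨s, q⟩` form complete sets of matrix units; `c s` is the common value
of the products `u' ⟨s, p⟩ * u ⟨s, p⟩`. -/
structure IsMatrixFamily {ι : Type*} {n : ι → Type*} [Fintype ι] [∀ s, Fintype (n s)]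
    {B : Type*} [Ring B] (u u' : (Σ s, n s) → B) (c : ι → B) : Prop where
  mul_self : ∀ x, u' x * u x = c x.1
  mul_ne : ∀ x y, x ≠ y → u' x * u y = 0
  mul_corner : ∀ x, u x * c x.1 = u x
  corner_mul : ∀ x, c x.1 * u' x = u' x
  sum_mul : ∑ x, u x * u' x = 1

namespace IsMatrixFamily

variable {ι : Type*} {n : ι → Type*} [Fintype ι] [∀ s, Fintype (n s)]
  {B : Type*} [Ring B] {u u' : (Σ s, n s) → B} {c : ι → B} (h : IsMatrixFamily u u' c)

/-- The element `∑ u x * a s * u' x`, where `x` runs over the pairs `⟨s, p⟩`: it is the block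
diagonal matrix with the entries `a s` on the diagonal. -/
def diag (_ : IsMatrixFamily u u' c) (a : ι → B) : B := ∑ x, u x * a x.1 * u' x

include h

theorem mul_diag (a : ι → B) (ha : ∀ s, c s * a s = a s) (x : Σ s, n s) :
    u' x * h.diag a = a x.1 * u' x := by
  classical
  rw [diag, Finset.mul_sum, Finset.sum_eq_single x]
  · rw [← mul_assoc, ← mul_assoc, h.mul_self, ha]
  · intro y _ hy
    rw [← mul_assoc, ← mul_assoc, h.mul_ne _ _ hy.symm, zero_mul, zero_mul]
  · simp

theorem diag_mul (a : ι → B) (ha : ∀ s, a s * c s = a s) (x : Σ s, n s) :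
    h.diag a * u x = u x * a x.1 := by
  classical
  rw [diag, Finset.sum_mul, Finset.sum_eq_single x]
  · rw [mul_assoc, h.mul_self, mul_assoc, ha]
  · intro y _ hy
    rw [mul_assoc, h.mul_ne _ _ hy, mul_zero]
  · simp

theorem diag_mul_diag (a b : ι → B) (ha : ∀ s, a s * c s = a s) :
    h.diag a * h.diag b = h.diag fun s => a s * b s := by
  rw [diag, diag, Finset.mul_sum]
  refine Finset.sum_congr rfl fun x _ => ?_
  rw [← mul_assoc, ← mul_assoc, show (∑ x, u x * a x.1 * u' x) = h.diag a from rfl,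
    h.diag_mul a ha, mul_assoc (u x)]

theorem diag_corner : h.diag c = 1 := by
  rw [← h.sum_mul]
  exact Finset.sum_congr rfl fun x _ => by rw [h.mul_corner]

theorem diag_zero : h.diag 0 = 0 := by simp [diag]

theorem diag_sum {κ : Type*} (t : Finset κ) (a : κ → ι → B) :
    ∑ i ∈ t, h.diag (a i) = h.diag fun s => ∑ i ∈ t, a i s := by
  simp only [diag, Finset.mul_sum, Finset.sum_mul]
  exact Finset.sum_comm

variable (K : Type*) [Field K] [Algebra K B]

omit h in
/-- The linear map that sends the matrix units to the products `u ⟨s, p⟩ * u' ⟨s, q⟩`. -/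
def matrixLinearMap (_ : IsMatrixFamily u u' c) : (∀ s, Matrix (n s) (n s) K) →ₗ[K] B where
  toFun M := ∑ s, ∑ p, ∑ q, M s p q • (u ⟨s, p⟩ * u' ⟨s, q⟩)
  map_add' M N := by simp [add_smul, Finset.sum_add_distrib]
  map_smul' r M := by simp [mul_smul, Finset.smul_sum]

theorem matrixLinearMap_mul (M : ∀ s, Matrix (n s) (n s) K) (x : Σ s, n s) :
    h.matrixLinearMap K M * u x = ∑ p, M x.1 p x.2 • u ⟨x.1, p⟩ := by
  classical
  obtain ⟨s, q⟩ := x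
  simp only [matrixLinearMap, LinearMap.coe_mk, AddHom.coe_mk, Finset.sum_mul, smul_mul_assoc]
  rw [Finset.sum_eq_single s]
  · refine Finset.sum_congr rfl fun p _ => ?_
    rw [Finset.sum_eq_single q]
    · rw [mul_assoc, h.mul_self]
      exact congrArg _ (h.mul_corner ⟨s, p⟩)
    · intro r _ hr
      rw [mul_assoc, h.mul_ne _ _ (by simpa using hr), mul_zero, smul_zero]
    · simp
  · intro t _ ht
    refine Finset.sum_eq_zero fun p _ => Finset.sum_eq_zero fun r _ => ?_
    rw [mul_assoc, h.mul_ne _ _ (fun h => ht (congrArg Sigma.fst h)), mul_zero, smul_zero]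
  · simp

/-- As `1` is the sum of the `u x * u' x`, elements of `B` are determined by their action on the
`u x`. -/
theorem ext_mul {a b : B} (hab : ∀ x, a * u x = b * u x) : a = b := by
  rw [← mul_one a, ← mul_one b, ← h.sum_mul, Finset.mul_sum, Finset.mul_sum]
  exact Finset.sum_congr rfl fun x _ => by rw [← mul_assoc, hab, mul_assoc]

variable [∀ s, DecidableEq (n s)]

/-- The homomorphism of algebras that sends the matrix units to the products
`u ⟨s, p⟩ * u' ⟨s, q⟩`. -/
def matrixHom : (∀ s, Matrix (n s) (n s) K) →ₐ[K] B :=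
  AlgHom.ofLinearMap (h.matrixLinearMap K)
    (h.ext_mul fun x => by
      rw [h.matrixLinearMap_mul, Finset.sum_eq_single x.2]
      · simp
      · intro p _ hp
        simp [hp]
      · simp)
    (fun M N => h.ext_mul fun x => by
      rw [mul_assoc, h.matrixLinearMap_mul, h.matrixLinearMap_mul, Finset.mul_sum]
      simp only [mul_smul_comm, h.matrixLinearMap_mul, Pi.mul_apply, Matrix.mul_apply,
        Finset.sum_smul, Finset.smul_sum, smul_smul]
      rw [Finset.sum_comm]
      simp only [mul_comm])

omit [∀ s, DecidableEq (n s)] in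
theorem mul_matrixLinearMap_mul (M : ∀ s, Matrix (n s) (n s) K) (s : ι) (p q : n s) :
    u' ⟨s, p⟩ * (h.matrixLinearMap K M * u ⟨s, q⟩) = M s p q • c s := by
  classical
  rw [h.matrixLinearMap_mul, Finset.mul_sum, Finset.sum_eq_single p]
  · rw [mul_smul_comm, h.mul_self]
  · intro r _ hr
    rw [mul_smul_comm, h.mul_ne _ _ (by simpa using hr.symm), smul_zero]
  · simp

theorem matrixHom_injective (hc : ∀ s, c s ≠ 0) : Function.Injective (h.matrixHom K) := by
  rw [injective_iff_map_eq_zero]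
  intro M hM
  have hM : h.matrixLinearMap K M = 0 := hM
  funext s
  ext p q
  have := h.mul_matrixLinearMap_mul K M s p q
  rw [hM, zero_mul, mul_zero] at this
  exact (smul_eq_zero.1 this.symm).resolve_right (hc s)

/-- Block diagonal matrices whose entries are constant on each block commute with the matrix
units. -/
theorem commute_matrixHom_diag (a : ι → B) (ha : ∀ s, c s * a s = a s) (ha' : ∀ s, a s * c s = a s)
    (M : ∀ s, Matrix (n s) (n s) K) : Commute (h.matrixHom K M) (h.diag a) := by
  change h.matrixLinearMap K M * h.diag a = h.diag a * h.matrixLinearMap K M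
  simp only [matrixLinearMap, LinearMap.coe_mk, AddHom.coe_mk, Finset.sum_mul, Finset.mul_sum]
  refine Finset.sum_congr rfl fun s _ => Finset.sum_congr rfl fun p _ =>
    Finset.sum_congr rfl fun q _ => ?_
  rw [smul_mul_assoc, mul_smul_comm, mul_assoc, h.mul_diag a ha, ← mul_assoc, ← mul_assoc,
    h.diag_mul a ha']

end IsMatrixFamily

end MatrixUnits

section MatrixGrading

variable (K : Type*) [Field K] {ι : Type*} {n : ι → Type*} [∀ s, Fintype (n s)]
  [∀ s, DecidableEq (n s)] (δ : ∀ s, n s → ℤ)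

instance : SetLike.GradedMonoid (matrixGrading K δ) where
  one_mem s p q h := by
    by_cases hpq : p = q
    · rw [hpq, sub_self]
    · simp [hpq] at h
  mul_mem i j M N hM hN s p q h := by
    obtain ⟨r, -, hr⟩ := Finset.exists_ne_zero_of_sum_ne_zero h
    have h1 := hM s p r (left_ne_zero_of_mul hr)
    have h2 := hN s r q (right_ne_zero_of_mul hr)
    omega

end MatrixGrading

namespace DirGraph

section Sinks

variable {V E : Type*} {G : DirGraph V E}

theorem IsPath.end_unique {p : List E} {v w w' : V} (h : G.IsPath v p w) (h' : G.IsPath v p w') :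
    w = w' := by
  induction p generalizing v with
  | nil => exact (show v = w from h).symm.trans h'
  | cons e p ih => exact ih h.2 h'.2

theorem IsPath.start_unique {p : List E} {v v' w : V} (h : G.IsPath v p w)
    (h' : G.IsPath v' p w) : v = v' := by
  cases p with
  | nil => exact (show v = w from h).trans (show v' = w from h').symm
  | cons e p => exact h.1.symm.trans h'.1

theorem IsPath.eq_nil_of_sink {p : List E} {v w : V} (h : G.IsPath v p w)
    (hv : ∀ e, G.src e ≠ v) : p = [] := by
  cases p with
  | nil => rfl
  | cons e p => exact absurd h.1 (hv e)

variable [Fintype V] [Fintype E] [DecidableEq V] {B : Type*} [Ring B] {f : LeavittGen V E → B}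

/-- Two distinct paths ending in sinks are not prefixes of each other. -/
theorem _root_.IsLeavittFamily.ghostElt_mul_pathElt_of_ne (hf : IsLeavittFamily G f) {p q : List E}
    {v v' w w' : V} (hp : G.IsPath v p w) (hq : G.IsPath v' q w') (hw : ∀ e, G.src e ≠ w)
    (hw' : ∀ e, G.src e ≠ w') (hne : ¬ (v = v' ∧ p = q)) :
    G.ghostElt f v p * G.pathElt f v' q = 0 := by
  classical
  induction p generalizing v v' q with
  | nil =>
    obtain rfl : v = w := hp
    refine hf.vert_mul_pathElt_of_ne hq fun h => hne ⟨h, ?_⟩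
    subst h
    exact (hq.eq_nil_of_sink hw).symm
  | cons e p ih =>
    cases q with
    | nil =>
      obtain rfl : v' = w' := hq
      exact hf.ghostElt_mul_vert_of_ne hp fun h => hw' e (hp.1.trans h)
    | cons d q =>
      rw [ghostElt, pathElt, mul_assoc, ← mul_assoc (f (ghost e))]
      by_cases hed : e = d
      · subst hed
        rw [hf.ghost_edge_self, hf.vert_mul_pathElt hq.2]
        exact ih hp.2 hq.2 fun h => hne ⟨hp.1.symm.trans hq.1, by rw [h.2]⟩
      · rw [hf.ghost_edge_ne _ _ hed, zero_mul, mul_zero]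

end Sinks

namespace Polycephaly

section Heads

variable {V E : Type*} {G : DirGraph V E} (P : G.Polycephaly)

theorem exists_mem_cyc_src_eq (s : Fin P.numCycles) : ∃ e ∈ P.cyc s, G.src e = P.cycVertex s := by
  obtain ⟨hne, hp, -⟩ := P.isCycle s
  generalize P.cyc s = C at hne hp
  cases C with
  | nil => exact absurd rfl hne
  | cons c C => exact ⟨c, by simp, hp.1⟩

theorem head_injective : Function.Injective P.head := by
  rintro (s | s) (t | t) h
  · obtain ⟨e, he, hes⟩ := P.exists_mem_cyc_src_eq s
    obtain ⟨d, hd, hdt⟩ := P.exists_mem_cyc_src_eq t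
    by_contra hst
    exact P.cyc_disjoint s t (fun h => hst (by rw [h])) e he d hd (hes.trans (h.trans hdt.symm))
  · obtain ⟨e, he, hes⟩ := P.exists_mem_cyc_src_eq s
    exact absurd (hes.trans h) (P.cyc_rose_disjoint s e he t)
  · obtain ⟨d, hd, hdt⟩ := P.exists_mem_cyc_src_eq t
    exact absurd (hdt.trans h.symm) (P.cyc_rose_disjoint t d hd s)
  · exact congrArg Sum.inr (P.roseVertex_injective h)

/-- The part of a path of `G` up to the first of the vertices `v_s` on it lies in `E_1`. -/
theorem exists_residual_isPath_of_isPath {p : List E} {v : V}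
    {s : Fin P.numCycles ⊕ Fin P.numRoses} (h : G.IsPath v p (P.head s)) :
    ∃ t q, P.residual.IsPath v q (P.head t) := by
  induction p generalizing v with
  | nil => exact ⟨s, [], h⟩
  | cons e p ih =>
    by_cases hv : ∃ t, v = P.head t
    · obtain ⟨t, ht⟩ := hv
      exact ⟨t, [], ht⟩
    · obtain ⟨t, q, hq⟩ := ih h.2
      obtain ⟨rfl, -⟩ := h
      exact ⟨t, ⟨e, not_exists.1 hv⟩ :: q, rfl, hq⟩

theorem exists_residual_isPath (v : V) : ∃ s q, P.residual.IsPath v q (P.head s) := by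
  rcases P.connected_to_head v with ⟨s, e, he, p, hp⟩ | ⟨s, p, hp⟩
  · obtain ⟨q, r, hqr⟩ := List.append_of_mem he
    have hC := (P.isCycle s).2.1
    rw [hqr] at hC
    obtain ⟨u, -, hu⟩ := IsPath.append_right G hC
    obtain rfl : G.src e = u := hu.1
    exact P.exists_residual_isPath_of_isPath (s := Sum.inl s) (hp.append hu)
  · exact P.exists_residual_isPath_of_isPath (s := Sum.inr s) hp

/-- The paths of `E_1` whose range is one of the vertices `v_s`, together with the index `s`. -/
abbrev HeadPath : Type _ := Σ s, P.residual.PathInto (P.head s)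

variable {P} in
/-- The index `s` is determined by the path, since the `v_s` are distinct. -/
theorem headPath_ext {x y : P.HeadPath} (h : x.2.start = y.2.start) (h' : x.2.edges = y.2.edges) :
    x = y := by
  obtain ⟨s, v, p, hp⟩ := x
  obtain ⟨t, w, q, hq⟩ := y
  simp only at h h'
  subst h h'
  obtain rfl := P.head_injective (hp.end_unique hq)
  rfl

/-- The trivial path at `v_s`. -/
def trivialPath (s : Fin P.numCycles ⊕ Fin P.numRoses) : P.HeadPath := ⟨s, P.head s, [], rfl⟩

end Heads

section GeneratorMatrices

variable {V E : Type*} {G : DirGraph V E} (P : G.Polycephaly) (K : Type*) [Field K]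

/-- The matrices that correspond to the generators of `L_K(E_1)`: all entries are `0` or `1`, and
the rows and columns are indexed by paths, on which the generators act by left multiplication. -/
noncomputable def genMatrix : LeavittGen V {e : E // ∀ s, G.src e ≠ P.head s} → P.MatrixSum K
  | vert v => fun _ => open Classical in .of fun p q => if p = q ∧ q.start = v then 1 else 0
  | edge e => fun _ => open Classical in .of fun p q => if p.edges = e :: q.edges then 1 else 0
  | ghost e => fun _ => open Classical in .of fun p q => if q.edges = e :: p.edges then 1 else 0

theorem genMatrix_mem (x : LeavittGen V {e : E // ∀ s, G.src e ≠ P.head s}) :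
    P.genMatrix K x ∈ P.matrixSumGrading K x.deg := by
  intro s p q h
  cases x with
  | vert v =>
    have h1 : p = q ∧ q.start = v := by by_contra hc; simp [genMatrix, hc] at h
    simp [h1.1, deg]
  | edge e =>
    have h1 : p.edges = e :: q.edges := by by_contra hc; simp [genMatrix, hc] at h
    simp [h1, deg]
  | ghost e =>
    have h1 : q.edges = e :: p.edges := by by_contra hc; simp [genMatrix, hc] at h
    simp [h1, deg]

end GeneratorMatrices

section MatrixUnits

variable {V E : Type*} [Fintype V] [Fintype E] [DecidableEq V] {G : DirGraph V E}
  {P : G.Polycephaly} {B : Type*} [Ring B]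
  {f : LeavittGen V {e : E // ∀ s, G.src e ≠ P.head s} → B}

variable (P f) in
/-- The element of `B` given by a path of `E_1` with range `v_s`. -/
def headElt (x : P.HeadPath) : B := P.residual.pathElt f x.2.start x.2.edges

variable (P f) in
/-- The element `p*` of `B` given by a path `p` of `E_1` with range `v_s`. -/
def headGhost (x : P.HeadPath) : B := P.residual.ghostElt f x.2.start x.2.edges

/-- Every vertex is the sum of the `p p*`, where `p` runs over the paths of `E_1` that start at it and
end in one of the `v_s`. This follows by induction on the maximal length of these paths: if `v` is
not one of the `v_s`, it is the sum of the `e e*` over the edges `e` with source `v`, and one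
inserts the formula for the range of `e` between `e` and `e*`. -/
theorem vert_eq_sum (hf : IsLeavittFamily P.residual f) (v : V) :
    (∑ x, if x.2.start = v then P.headElt f x * P.headGhost f x else 0) = f (vert v) := by
  classical
  obtain ⟨N, hN⟩ : ∃ N, ∀ x : P.HeadPath, x.2.start = v → x.2.edges.length ≤ N :=
    ⟨Finset.univ.sup fun x : P.HeadPath => x.2.edges.length,
      fun x _ => Finset.le_sup (f := fun x : P.HeadPath => x.2.edges.length) (Finset.mem_univ x)⟩
  have head_case : ∀ s, (∑ x : P.HeadPath, if x.2.start = P.head s then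
      P.headElt f x * P.headGhost f x else 0) = f (vert (P.head s)) := by
    intro s
    rw [Finset.sum_eq_single (P.trivialPath s)]
    · simp only [trivialPath, if_true, headElt, headGhost, pathElt, ghostElt]
      exact hf.vert_self _
    · intro x _ hx
      refine if_neg fun h => hx (headPath_ext h ?_)
      exact x.2.isPath.eq_nil_of_sink fun e => by rw [h]; exact e.2 s
    · simp
  induction N generalizing v with
  | zero =>
    obtain ⟨s, q, hq⟩ := P.exists_residual_isPath v
    have := hN ⟨s, v, q, hq⟩ rfl
    obtain rfl : q = [] := List.length_eq_zero_iff.1 (Nat.le_zero.1 this)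
    obtain rfl : v = P.head s := hq
    exact head_case s
  | succ N ih =>
    by_cases hv : ∃ s, v = P.head s
    · obtain ⟨s, rfl⟩ := hv
      exact head_case s
    have hedge : ∃ e, P.residual.src e = v := by
      obtain ⟨s, q, hq⟩ := P.exists_residual_isPath v
      cases q with
      | nil => exact absurd ⟨s, hq⟩ hv
      | cons e q => exact ⟨e, hq.1⟩
    have step : ∀ e, (if P.residual.src e = v then f (edge e) * f (ghost e) else 0) =
        ∑ x : P.HeadPath, if P.residual.src e = v ∧ x.2.start = P.residual.rng e then
          f (edge e) * (P.headElt f x * P.headGhost f x) * f (ghost e) else 0 := by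
      intro e
      by_cases he : P.residual.src e = v
      · rw [if_pos he, ← congrArg (· * f (ghost e)) (hf.edge_rng e),
          ← ih (P.residual.rng e), Finset.mul_sum, Finset.sum_mul]
        · refine Finset.sum_congr rfl fun x _ => ?_
          by_cases hx : x.2.start = P.residual.rng e <;> simp [hx, he]
        · intro x hx
          have := hN ⟨x.1, v, e :: x.2.edges, he, hx ▸ x.2.isPath⟩ rfl
          simpa using this
      · simp [he]
    rw [← hf.sum_edge_ghost v hedge, Finset.sum_congr rfl fun e _ => step e,
      ← Fintype.sum_prod_type', ← Finset.sum_filter, ← Finset.sum_filter]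
    symm
    refine Finset.sum_bij (fun y hy => ⟨y.2.1, P.residual.src y.1, y.1 :: y.2.2.edges, rfl,
      (Finset.mem_filter.1 hy).2.2 ▸ y.2.2.isPath⟩) ?_ ?_ ?_ ?_
    · intro y hy
      exact Finset.mem_filter.2 ⟨Finset.mem_univ _, (Finset.mem_filter.1 hy).2.1⟩
    · rintro ⟨e, x⟩ hx ⟨d, y⟩ hy h
      have h1 := congrArg (fun x : P.HeadPath => x.2.edges) h
      simp only [List.cons.injEq] at h1
      obtain ⟨rfl, h1⟩ := h1
      exact congrArg (Prod.mk e) (headPath_ext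
        ((Finset.mem_filter.1 hx).2.2.trans (Finset.mem_filter.1 hy).2.2.symm) h1)
    · rintro ⟨s, w, q, hq⟩ hx
      obtain rfl : w = v := (Finset.mem_filter.1 hx).2
      cases q with
      | nil => exact absurd ⟨s, hq⟩ hv
      | cons e q =>
        exact ⟨(e, ⟨s, _, q, hq.2⟩), Finset.mem_filter.2 ⟨Finset.mem_univ _, hq.1, rfl⟩,
          headPath_ext hq.1 rfl⟩
    · rintro ⟨e, x⟩ hx
      have := (Finset.mem_filter.1 hx).2.2
      simp only at this
      simp only [headElt, headGhost, pathElt, ghostElt, this, mul_assoc]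

/-- The paths of `E_1` into the vertices `v_s` give matrix units in any algebra with a Leavitt
family for `E_1`. -/
theorem isMatrixFamily (hf : IsLeavittFamily P.residual f) :
    IsMatrixFamily (P.headElt f) (P.headGhost f) fun s => f (vert (P.head s)) where
  mul_self x := hf.ghostElt_mul_pathElt_self x.2.isPath
  mul_ne x y hxy := hf.ghostElt_mul_pathElt_of_ne x.2.isPath y.2.isPath (fun e => e.2 _)
    (fun e => e.2 _) fun h => hxy (headPath_ext h.1 h.2)
  mul_corner x := hf.pathElt_mul_vert x.2.isPath
  corner_mul x := hf.vert_mul_ghostElt x.2.isPath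
  sum_mul := by
    rw [← hf.sum_vert, ← Finset.sum_congr rfl fun v _ => vert_eq_sum hf v, Finset.sum_comm]
    simp

variable (P) (K : Type*) [Field K]

theorem matrixHom_genMatrix [Algebra K B] (hf : IsLeavittFamily P.residual f)
    (x : LeavittGen V {e : E // ∀ s, G.src e ≠ P.head s}) :
    (isMatrixFamily hf).matrixHom K (P.genMatrix K x) = f x := by
  classical
  have hcons : ∀ e s (p q : P.residual.PathInto (P.head s)), p.edges = e :: q.edges →
      p.start = P.residual.src e ∧ q.start = P.residual.rng e := by
    intro e s p q h
    have := p.isPath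
    rw [h] at this
    exact ⟨this.1.symm, q.isPath.start_unique this.2⟩
  have single : ∀ s (D : P.MatrixSum K) (q p₀ : P.residual.PathInto (P.head s)),
      D s p₀ q = 1 → (∀ p, D s p q ≠ 0 → p = p₀) →
      ∑ p, D s p q • P.headElt f ⟨s, p⟩ = P.headElt f ⟨s, p₀⟩ := by
    intro s D q p₀ h1 h0
    rw [Finset.sum_eq_single p₀, h1, one_smul]
    · intro p _ hp
      rw [not_not.1 (mt (h0 p) hp), zero_smul]
    · simp
  have zero : ∀ s (D : P.MatrixSum K) (q : P.residual.PathInto (P.head s)),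
      (∀ p, D s p q = 0) → ∑ p, D s p q • P.headElt f ⟨s, p⟩ = 0 := by
    intro s D q h
    exact Finset.sum_eq_zero fun p _ => by rw [h, zero_smul]
  refine (isMatrixFamily hf).ext_mul fun y => ?_
  refine ((isMatrixFamily hf).matrixLinearMap_mul K _ y).trans ?_
  obtain ⟨s, q⟩ := y
  cases x with
  | vert v =>
    by_cases hv : v = q.start
    · subst hv
      rw [single s _ q q (by simp [genMatrix])]
      · exact (hf.vert_mul_pathElt q.isPath).symm
      · intro p hp
        by_contra hc
        simp [genMatrix, hc] at hp
    · rw [zero s _ q fun p => by simp [genMatrix, Ne.symm hv]]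
      exact (hf.vert_mul_pathElt_of_ne q.isPath hv).symm
  | edge e =>
    by_cases he : q.start = P.residual.rng e
    · let p₀ : P.residual.PathInto (P.head s) :=
        ⟨P.residual.src e, e :: q.edges, rfl, he ▸ q.isPath⟩
      rw [single s _ q p₀ (by simp [genMatrix, p₀])]
      · simp only [headElt, p₀, pathElt, he]
      · intro p hp
        have h1 : p.edges = e :: q.edges := by by_contra hc; simp [genMatrix, hc] at hp
        have h2 := headPath_ext (x := ⟨s, p⟩) (y := ⟨s, p₀⟩) (hcons e s p q h1).1 h1
        simpa using h2
    · rw [zero s _ q fun p => by simp [genMatrix, mt (fun h => (hcons e s p q h).2) he]]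
      simp only [headElt]
      rw [← hf.vert_mul_pathElt q.isPath, ← mul_assoc, hf.edge_mul_vert_of_ne (Ne.symm he),
        zero_mul]
  | ghost e =>
    obtain ⟨w, l, hl⟩ := q
    cases l with
    | nil =>
      rw [zero s _ _ fun p => by simp [genMatrix]]
      obtain rfl : w = P.head s := hl
      exact (hf.ghost_mul_vert_of_ne (e.2 s)).symm
    | cons d l =>
      simp only [headElt, pathElt]
      rw [← mul_assoc]
      by_cases hed : e = d
      · subst hed
        rw [hf.ghost_edge_self, hf.vert_mul_pathElt hl.2]
        refine single s _ _ ⟨_, l, hl.2⟩ (by simp [genMatrix]) ?_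
        intro p hp
        have h1 : l = p.edges := by
          by_contra hc
          simp [genMatrix, hc] at hp
        have h2 := headPath_ext (x := ⟨s, p⟩) (y := ⟨s, ⟨_, l, hl.2⟩⟩)
          (p.isPath.start_unique (h1 ▸ hl.2)) h1.symm
        simpa using h2
      · rw [hf.ghost_edge_ne _ _ hed, zero_mul]
        exact zero s _ _ fun p => by simp [genMatrix, Ne.symm hed]

/-- All generators are in the image, by `matrixHom_genMatrix`. -/
theorem matrixHom_gen_surjective : Function.Surjective
    ((isMatrixFamily (LeavittPathAlgebra.isLeavittFamily_gen K P.residual)).matrixHom K) := by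
  intro a
  obtain ⟨b, rfl⟩ := LeavittPathAlgebra.proj_surjective a
  refine ⟨FreeAlgebra.lift K (P.genMatrix K) b, ?_⟩
  have := FreeAlgebra.hom_ext
    (f := ((isMatrixFamily (LeavittPathAlgebra.isLeavittFamily_gen K P.residual)).matrixHom K).comp
      (FreeAlgebra.lift K (P.genMatrix K)))
    (g := LeavittPathAlgebra.proj K P.residual) (by
      funext x
      simp only [Function.comp_apply, AlgHom.comp_apply, FreeAlgebra.lift_ι_apply]
      exact matrixHom_genMatrix P K (LeavittPathAlgebra.isLeavittFamily_gen K P.residual) x)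
  exact DFunLike.congr_fun this b

/-- The algebra of the acyclic graph `E_1` is the direct sum of the matrix algebras over the sinks
of `E_1`. Injectivity holds since the vertices of `E_1` are nonzero. -/
noncomputable def matrixEquiv : P.MatrixSum K ≃ₐ[K] LeavittPathAlgebra K P.residual :=
  AlgEquiv.ofBijective
    ((isMatrixFamily (LeavittPathAlgebra.isLeavittFamily_gen K P.residual)).matrixHom K)
    ⟨IsMatrixFamily.matrixHom_injective _ K fun _ => LeavittPathAlgebra.vert_ne_zero K _ _,
      matrixHom_gen_surjective P K⟩

theorem matrixEquiv_genMatrix (x : LeavittGen V {e : E // ∀ s, G.src e ≠ P.head s}) :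
    P.matrixEquiv K (P.genMatrix K x) = LeavittPathAlgebra.gen K P.residual x :=
  matrixHom_genMatrix P K (LeavittPathAlgebra.isLeavittFamily_gen K P.residual) x

end MatrixUnits

end Polycephaly

section PathDegree

variable {V E : Type*} {K : Type*} [Field K]

theorem pathElt_mem {G : DirGraph V E} {B : Type*} [Ring B] [Algebra K B] {ℬ : ℤ → Submodule K B}
    [SetLike.GradedMonoid ℬ] {f : LeavittGen V E → B} (hf : ∀ x, f x ∈ ℬ x.deg) (v : V)
    (p : List E) : G.pathElt f v p ∈ ℬ p.length := by
  induction p generalizing v with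
  | nil => exact hf (vert v)
  | cons e p ih =>
    rw [pathElt, List.length_cons, Nat.cast_succ, add_comm]
    exact SetLike.GradedMul.mul_mem (hf (edge e)) (ih _)

theorem ghostElt_mem {G : DirGraph V E} {B : Type*} [Ring B] [Algebra K B] {ℬ : ℤ → Submodule K B}
    [SetLike.GradedMonoid ℬ] {f : LeavittGen V E → B} (hf : ∀ x, f x ∈ ℬ x.deg) (v : V)
    (p : List E) : G.ghostElt f v p ∈ ℬ (-p.length) := by
  induction p generalizing v with
  | nil => exact hf (vert v)
  | cons e p ih =>
    rw [ghostElt, List.length_cons, Nat.cast_succ, neg_add]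
    exact SetLike.GradedMul.mul_mem (ih _) (hf (ghost e))

end PathDegree

namespace Polycephaly

variable {V E : Type*} [Fintype V] [Fintype E] [DecidableEq V] {G : DirGraph V E}
  (P : G.Polycephaly) (K : Type*) [Field K]

theorem gradedAlgIso_matrixSum :
    GradedAlgIso K (LeavittPathAlgebra.grading K P.residual) (P.matrixSumGrading K) := by
  have : SetLike.GradedMonoid (P.matrixSumGrading K) :=
    inferInstanceAs (SetLike.GradedMonoid (matrixGrading K _))
  refine GradedAlgIso.of_algEquiv (P.matrixEquiv K).symm (fun k a ha => ?_) fun k M hM => ?_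
  · refine LeavittPathAlgebra.map_mem_of_gen (fun k c b hb => Submodule.smul_mem _ c hb)
      (P.matrixEquiv K).symm.toAlgHom (fun x => ?_) ha
    have h : (P.matrixEquiv K).symm (LeavittPathAlgebra.gen K P.residual x) = P.genMatrix K x := by
      rw [AlgEquiv.symm_apply_eq, matrixEquiv_genMatrix]
    exact h ▸ P.genMatrix_mem K x
  · change (∑ s, ∑ p, ∑ q, M s p q • (P.headElt (LeavittPathAlgebra.gen K P.residual) ⟨s, p⟩ *
      P.headGhost (LeavittPathAlgebra.gen K P.residual) ⟨s, q⟩)) ∈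
        LeavittPathAlgebra.grading K P.residual k
    refine sum_mem fun s _ => sum_mem fun p _ => sum_mem fun q _ => ?_
    by_cases h : M s p q = 0
    · rw [h, zero_smul]
      exact zero_mem _
    · refine Submodule.smul_mem _ _ ?_
      rw [← hM s p q h, sub_eq_add_neg]
      exact SetLike.GradedMul.mul_mem (pathElt_mem LeavittPathAlgebra.gen_mem_grading _ _)
        (ghostElt_mem LeavittPathAlgebra.gen_mem_grading _ _)

end Polycephaly

end DirGraph

/-! ### Splitting off the algebra of a rose -/

section TensorGrading

variable {K : Type*} [Field K] {A B : Type*} [Ring A] [Ring B] [Algebra K A] [Algebra K B]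
  {𝒜 : ℤ → Submodule K A} {ℬ : ℤ → Submodule K B}

theorem tmul_mem_tensorGrading {i j : ℤ} {a : A} {b : B} (ha : a ∈ 𝒜 i) (hb : b ∈ ℬ j) :
    a ⊗ₜ[K] b ∈ tensorGrading 𝒜 ℬ (i + j) :=
  Submodule.subset_span ⟨i, j, rfl, a, ha, b, hb, rfl⟩

instance [SetLike.GradedMonoid 𝒜] [SetLike.GradedMonoid ℬ] :
    SetLike.GradedMonoid (tensorGrading 𝒜 ℬ) where
  one_mem := tmul_mem_tensorGrading (i := 0) (j := 0) SetLike.GradedOne.one_mem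
    SetLike.GradedOne.one_mem
  mul_mem i j x y hx hy := by
    refine Submodule.span_induction₂ (p := fun x y _ _ => x * y ∈ tensorGrading 𝒜 ℬ (i + j))
      ?_ ?_ ?_ ?_ ?_ ?_ ?_ hx hy
    · rintro _ _ ⟨i, j, rfl, a, ha, b, hb, rfl⟩ ⟨k, l, rfl, c, hc, d, hd, rfl⟩
      rw [Algebra.TensorProduct.tmul_mul_tmul, add_add_add_comm]
      exact tmul_mem_tensorGrading (SetLike.GradedMul.mul_mem ha hc)
        (SetLike.GradedMul.mul_mem hb hd)
    · intros; simp
    · intros; simp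
    · intro x y z _ _ _ h h'; rw [add_mul]; exact add_mem h h'
    · intro x y z _ _ _ h h'; rw [mul_add]; exact add_mem h h'
    · intro r x y _ _ h; rw [smul_mul_assoc]; exact Submodule.smul_mem _ _ h
    · intro r x y _ _ h; rw [mul_smul_comm]; exact Submodule.smul_mem _ _ h

/-- A homomorphism that sends `a ⊗ b` to `f a * g b` is graded if `f` and `g` are. -/
theorem lift_mem_of_mem_tensorGrading {C τ : Type*} [Ring C] [Algebra K C] [SetLike τ C]
    [AddSubgroupClass τ C] {𝒞 : ℤ → τ} [SetLike.GradedMonoid 𝒞]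
    (hsmul : ∀ k (c : K), ∀ b ∈ 𝒞 k, c • b ∈ 𝒞 k) {f : A →ₐ[K] C} {g : B →ₐ[K] C}
    (hfg : ∀ a b, Commute (f a) (g b)) (hf : ∀ i, ∀ a ∈ 𝒜 i, f a ∈ 𝒞 i)
    (hg : ∀ j, ∀ b ∈ ℬ j, g b ∈ 𝒞 j) {k : ℤ} {x : A ⊗[K] B} (hx : x ∈ tensorGrading 𝒜 ℬ k) :
    Algebra.TensorProduct.lift f g hfg x ∈ 𝒞 k := by
  refine Submodule.span_induction ?_ (by rw [map_zero]; exact zero_mem _)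
    (fun x y _ _ hx hy => by rw [map_add]; exact add_mem hx hy)
    (fun c x _ hx => by rw [map_smul]; exact hsmul _ _ _ hx) hx
  rintro _ ⟨i, j, rfl, a, ha, b, hb, rfl⟩
  rw [Algebra.TensorProduct.lift_tmul]
  exact SetLike.GradedMul.mul_mem (hf i a ha) (hg j b hb)

end TensorGrading

namespace DirGraph.Polycephaly

variable {V E : Type*} {G : DirGraph V E} (P : G.Polycephaly)

/-- Data that turn all heads of a polycephaly graph into roses with `n` petals: all edges
emitted by the `v_s` are loops, and they are numbered by `Fin n`. -/
structure RoseHeads (n : ℕ) where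
  /-- The numbering of the edges with source `v_s`. -/
  petal : ∀ s, Fin n ≃ {e : E // G.src e = P.head s}
  rng_petal : ∀ s i, G.rng (petal s i).1 = P.head s

/-- The inclusion of generators of `L_K(E_1)` into those of `L_K(E)`. -/
def inclGen : LeavittGen V {e : E // ∀ s, G.src e ≠ P.head s} → LeavittGen V E
  | vert v => vert v
  | edge e => edge e.1
  | ghost e => ghost e.1

theorem deg_inclGen (x : LeavittGen V {e : E // ∀ s, G.src e ≠ P.head s}) :
    (P.inclGen x).deg = x.deg := by
  cases x <;> rfl

namespace RoseHeads

variable {P} {n : ℕ} (R : P.RoseHeads n)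

theorem edge_cases (e : E) :
    (∃ s i, e = (R.petal s i).1) ∨ ∃ d : {e : E // ∀ s, G.src e ≠ P.head s}, e = d.1 := by
  by_cases h : ∃ s, G.src e = P.head s
  · obtain ⟨s, hs⟩ := h
    exact Or.inl ⟨s, (R.petal s).symm ⟨e, hs⟩, by simp⟩
  · exact Or.inr ⟨⟨e, not_exists.1 h⟩, rfl⟩

section ToTensorGen

variable (K : Type*) [Field K]

open LeavittPathAlgebra

/-- The images of the generators of `L_K(E)` in `L_K(E_1) ⊗ L_K(1, n)`: the `i`-th petal at `v_s`
goes to `v_s ⊗ x_i`, and the generators of `L_K(E_1)` to themselves. The index `s` of an edge with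
source `v_s` is chosen, but it is unique, as the `v_s` are distinct. -/
noncomputable def toTensorGen : LeavittGen V E →
    LeavittPathAlgebra K P.residual ⊗[K] LeavittPathAlgebra K (rose n)
  | vert v => gen K P.residual (vert v) ⊗ₜ 1
  | edge e => open Classical in if h : ∃ s, G.src e = P.head s then
      gen K P.residual (vert (G.src e)) ⊗ₜ
        gen K (rose n) (edge ((R.petal h.choose).symm ⟨e, h.choose_spec⟩))
    else gen K P.residual (edge ⟨e, not_exists.1 h⟩) ⊗ₜ 1
  | ghost e => open Classical in if h : ∃ s, G.src e = P.head s then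
      gen K P.residual (vert (G.src e)) ⊗ₜ
        gen K (rose n) (ghost ((R.petal h.choose).symm ⟨e, h.choose_spec⟩))
    else gen K P.residual (ghost ⟨e, not_exists.1 h⟩) ⊗ₜ 1

theorem symm_petal_eq (s) (i : Fin n) (h : ∃ t, G.src (R.petal s i).1 = P.head t) :
    (R.petal h.choose).symm ⟨(R.petal s i).1, h.choose_spec⟩ = i := by
  have key : ∀ t (ht : G.src (R.petal s i).1 = P.head t),
      (R.petal t).symm ⟨(R.petal s i).1, ht⟩ = i := by
    intro t ht
    obtain rfl := P.head_injective ((R.petal s i).2.symm.trans ht)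
    simp
  exact key _ _

theorem toTensorGen_edge_petal (s) (i : Fin n) : R.toTensorGen K (edge (R.petal s i).1) =
    gen K P.residual (vert (P.head s)) ⊗ₜ gen K (rose n) (edge i) := by
  have h : ∃ t, G.src (R.petal s i).1 = P.head t := ⟨s, (R.petal s i).2⟩
  rw [toTensorGen, dif_pos h, R.symm_petal_eq s i h, (R.petal s i).2]

theorem toTensorGen_ghost_petal (s) (i : Fin n) : R.toTensorGen K (ghost (R.petal s i).1) =
    gen K P.residual (vert (P.head s)) ⊗ₜ gen K (rose n) (ghost i) := by
  have h : ∃ t, G.src (R.petal s i).1 = P.head t := ⟨s, (R.petal s i).2⟩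
  rw [toTensorGen, dif_pos h, R.symm_petal_eq s i h, (R.petal s i).2]

theorem toTensorGen_inclGen (x : LeavittGen V {e : E // ∀ s, G.src e ≠ P.head s}) :
    R.toTensorGen K (P.inclGen x) = gen K P.residual x ⊗ₜ 1 := by
  cases x with
  | vert v => rfl
  | edge e => rw [inclGen, toTensorGen, dif_neg (not_exists.2 e.2)]
  | ghost e => rw [inclGen, toTensorGen, dif_neg (not_exists.2 e.2)]

theorem toTensorGen_edge_residual (e : {e : E // ∀ s, G.src e ≠ P.head s}) :
    R.toTensorGen K (edge e.1) = gen K P.residual (edge e) ⊗ₜ 1 :=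
  R.toTensorGen_inclGen K (edge e)

theorem toTensorGen_ghost_residual (e : {e : E // ∀ s, G.src e ≠ P.head s}) :
    R.toTensorGen K (ghost e.1) = gen K P.residual (ghost e) ⊗ₜ 1 :=
  R.toTensorGen_inclGen K (ghost e)

theorem toTensorGen_mem (x : LeavittGen V E) : R.toTensorGen K x ∈
    tensorGrading (grading K P.residual) (grading K (rose n)) x.deg := by
  have hres : ∀ y, gen K P.residual y ⊗ₜ[K] 1 ∈
      tensorGrading (grading K P.residual) (grading K (rose n)) y.deg := fun y => by
    have := tmul_mem_tensorGrading (gen_mem_grading (K := K) (G := P.residual) y)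
      (SetLike.GradedOne.one_mem (A := grading K (rose n)))
    rwa [add_zero] at this
  have hrose : ∀ s y, gen K P.residual (vert (P.head s)) ⊗ₜ[K] gen K (rose n) y ∈
      tensorGrading (grading K P.residual) (grading K (rose n)) y.deg := fun s y => by
    have := tmul_mem_tensorGrading (gen_mem_grading (K := K) (G := P.residual) (vert (P.head s)))
      (gen_mem_grading (K := K) (G := rose n) y)
    rwa [show deg (vert (P.head s) : LeavittGen V {e : E // ∀ s, G.src e ≠ P.head s}) = 0 from rfl,
      zero_add] at this
  cases x with
  | vert v => exact hres (vert v)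
  | edge e =>
    rcases R.edge_cases e with ⟨s, i, rfl⟩ | ⟨e, rfl⟩
    · rw [toTensorGen_edge_petal]
      exact hrose s (edge i)
    · rw [toTensorGen_edge_residual]
      exact hres (edge e)
  | ghost e =>
    rcases R.edge_cases e with ⟨s, i, rfl⟩ | ⟨e, rfl⟩
    · rw [toTensorGen_ghost_petal]
      exact hrose s (ghost i)
    · rw [toTensorGen_ghost_residual]
      exact hres (ghost e)

end ToTensorGen

variable [Fintype E] [DecidableEq V]

theorem sum_src_eq_head {B : Type*} [AddCommMonoid B] (g : E → B)
    (s : Fin P.numCycles ⊕ Fin P.numRoses) :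
    (∑ e, if G.src e = P.head s then g e else 0) = ∑ i, g (R.petal s i).1 := by
  rw [← Finset.sum_filter, Equiv.sum_comp (R.petal s) fun e => g e.1]
  exact Finset.sum_subtype _ (by simp) _

end RoseHeads

variable [Fintype E] [DecidableEq V]

theorem sum_src_eq_of_ne_head {B : Type*} [AddCommMonoid B] (g : E → B) {v : V}
    (hv : ∀ s, v ≠ P.head s) : (∑ e, if G.src e = v then g e else 0) =
      ∑ e : {e : E // ∀ s, G.src e ≠ P.head s}, if P.residual.src e = v then g e.1 else 0 := by
  rw [← Fintype.sum_subtype_add_sum_subtype (fun e => ∀ s, G.src e ≠ P.head s)]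
  refine (congrArg _ (Finset.sum_eq_zero fun e _ => if_neg fun h => e.2 ?_)).trans (add_zero _)
  exact h ▸ hv

variable [Fintype V]

theorem isLeavittFamily_inclGen {B : Type*} [Ring B] {f : LeavittGen V E → B}
    (hf : IsLeavittFamily G f) : IsLeavittFamily P.residual fun x => f (P.inclGen x) where
  vert_self := hf.vert_self
  vert_ne := hf.vert_ne
  src_edge e := hf.src_edge e.1
  edge_rng e := hf.edge_rng e.1
  rng_ghost e := hf.rng_ghost e.1
  ghost_src e := hf.ghost_src e.1
  ghost_edge_self e := hf.ghost_edge_self e.1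
  ghost_edge_ne e d h := hf.ghost_edge_ne e.1 d.1 fun h' => h (Subtype.ext h')
  sum_edge_ghost := by
    rintro v ⟨e, rfl⟩
    exact (P.sum_src_eq_of_ne_head (fun e => f (edge e) * f (ghost e)) e.2).symm.trans
      (hf.sum_edge_ghost (P.residual.src e) ⟨e.1, rfl⟩)
  sum_vert := hf.sum_vert

namespace RoseHeads

variable {P} {n : ℕ} (R : P.RoseHeads n)

section Diagonal

variable {B : Type*} [Ring B] {f : LeavittGen V E → B} (hf : IsLeavittFamily G f)

/-- The generators of `L_K(1, n)` inside an algebra `B` with a Leavitt family for `E`: the `i`-th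
petal goes to the sum of the `p α_{s,i} p*`, where `α_{s,i}` is the `i`-th petal at `v_s` and `p`
runs over the paths of `E_1` into `v_s`. -/
noncomputable def roseGen : LeavittGen Unit (Fin n) → B
  | vert _ => 1
  | edge i => (isMatrixFamily (P.isLeavittFamily_inclGen hf)).diag
      fun s => f (edge (R.petal s i).1)
  | ghost i => (isMatrixFamily (P.isLeavittFamily_inclGen hf)).diag
      fun s => f (ghost (R.petal s i).1)

theorem roseGen_edge (i : Fin n) : R.roseGen hf (edge i) =
    (isMatrixFamily (P.isLeavittFamily_inclGen hf)).diag fun s => f (edge (R.petal s i).1) :=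
  rfl

theorem roseGen_ghost (i : Fin n) : R.roseGen hf (ghost i) =
    (isMatrixFamily (P.isLeavittFamily_inclGen hf)).diag fun s => f (ghost (R.petal s i).1) :=
  rfl

include hf

theorem vert_mul_petal (s) (i : Fin n) :
    f (vert (P.head s)) * f (edge (R.petal s i).1) = f (edge (R.petal s i).1) := by
  have h := hf.src_edge (R.petal s i).1
  rwa [(R.petal s i).2] at h

theorem petal_mul_vert (s) (i : Fin n) :
    f (edge (R.petal s i).1) * f (vert (P.head s)) = f (edge (R.petal s i).1) := by
  have h := hf.edge_rng (R.petal s i).1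
  rwa [R.rng_petal] at h

theorem vert_mul_petal_ghost (s) (i : Fin n) :
    f (vert (P.head s)) * f (ghost (R.petal s i).1) = f (ghost (R.petal s i).1) := by
  have h := hf.rng_ghost (R.petal s i).1
  rwa [R.rng_petal] at h

theorem petal_ghost_mul_vert (s) (i : Fin n) :
    f (ghost (R.petal s i).1) * f (vert (P.head s)) = f (ghost (R.petal s i).1) := by
  have h := hf.ghost_src (R.petal s i).1
  rwa [(R.petal s i).2] at h

theorem isLeavittFamily_roseGen : IsLeavittFamily (rose n) (R.roseGen hf) where
  vert_self _ := one_mul _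
  vert_ne v w h := absurd rfl h
  src_edge _ := one_mul _
  edge_rng _ := mul_one _
  rng_ghost _ := one_mul _
  ghost_src _ := mul_one _
  ghost_edge_self i := by
    rw [roseGen_ghost, roseGen_edge, (isMatrixFamily (P.isLeavittFamily_inclGen hf)).diag_mul_diag _ _
      fun s => R.petal_ghost_mul_vert hf s i]
    refine Eq.trans ?_ (isMatrixFamily (P.isLeavittFamily_inclGen hf)).diag_corner
    congr 1
    funext s
    rw [hf.ghost_edge_self, R.rng_petal]
    rfl
  ghost_edge_ne i j h := by
    rw [roseGen_ghost, roseGen_edge, (isMatrixFamily (P.isLeavittFamily_inclGen hf)).diag_mul_diag _ _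
      fun s => R.petal_ghost_mul_vert hf s i]
    refine Eq.trans ?_ (isMatrixFamily (P.isLeavittFamily_inclGen hf)).diag_zero
    congr 1
    funext s
    exact hf.ghost_edge_ne _ _ fun h' => h ((R.petal s).injective (Subtype.ext h'))
  sum_edge_ghost := by
    rintro - ⟨i, -⟩
    refine Eq.trans ?_ (isMatrixFamily (P.isLeavittFamily_inclGen hf)).diag_corner
    have : ∀ i, R.roseGen hf (edge i) * R.roseGen hf (ghost i) =
        (isMatrixFamily (P.isLeavittFamily_inclGen hf)).diag
          fun s => f (edge (R.petal s i).1) * f (ghost (R.petal s i).1) := fun i => by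
      rw [roseGen_ghost, roseGen_edge, (isMatrixFamily (P.isLeavittFamily_inclGen hf)).diag_mul_diag _ _
        fun s => R.petal_mul_vert hf s i]
    simp only [this, if_true]
    rw [IsMatrixFamily.diag_sum]
    congr 1
    funext s
    rw [← R.sum_src_eq_head (fun e => f (edge e) * f (ghost e))]
    exact hf.sum_edge_ghost _ ⟨(R.petal s i).1, (R.petal s i).2⟩
  sum_vert := by simp [roseGen]

end Diagonal

section Tensor

variable (K : Type*) [Field K]

open LeavittPathAlgebra

theorem isLeavittFamily_toTensorGen : IsLeavittFamily G (R.toTensorGen K) := by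
  have h1 := isLeavittFamily_gen K P.residual
  have h2 := isLeavittFamily_gen K (rose n)
  have hv : ∀ v, R.toTensorGen K (vert v) = gen K P.residual (vert v) ⊗ₜ 1 := fun v => rfl
  have hs : ∀ s i, G.src (R.petal s i).1 = P.head s := fun s i => (R.petal s i).2
  have hd : ∀ s, gen K P.residual (vert (P.head s)) * gen K P.residual (vert (P.head s)) =
    gen K P.residual (vert (P.head s)) := fun s => h1.vert_self _
  constructor
  · intro v
    rw [hv, Algebra.TensorProduct.tmul_mul_tmul, h1.vert_self, one_mul]
  · intro v w h
    rw [hv, hv, Algebra.TensorProduct.tmul_mul_tmul, h1.vert_ne _ _ h, TensorProduct.zero_tmul]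
  · intro e
    rcases R.edge_cases e with ⟨s, i, rfl⟩ | ⟨e, rfl⟩
    · rw [toTensorGen_edge_petal, hs, hv, Algebra.TensorProduct.tmul_mul_tmul, hd, one_mul]
    · rw [toTensorGen_edge_residual, hv, Algebra.TensorProduct.tmul_mul_tmul, one_mul]
      exact congrArg (· ⊗ₜ 1) (h1.src_edge e)
  · intro e
    rcases R.edge_cases e with ⟨s, i, rfl⟩ | ⟨e, rfl⟩
    · rw [toTensorGen_edge_petal, R.rng_petal, hv, Algebra.TensorProduct.tmul_mul_tmul, hd, mul_one]
    · rw [toTensorGen_edge_residual, hv, Algebra.TensorProduct.tmul_mul_tmul, one_mul]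
      exact congrArg (· ⊗ₜ 1) (h1.edge_rng e)
  · intro e
    rcases R.edge_cases e with ⟨s, i, rfl⟩ | ⟨e, rfl⟩
    · rw [toTensorGen_ghost_petal, R.rng_petal, hv, Algebra.TensorProduct.tmul_mul_tmul, hd, one_mul]
    · rw [toTensorGen_ghost_residual, hv, Algebra.TensorProduct.tmul_mul_tmul, one_mul]
      exact congrArg (· ⊗ₜ 1) (h1.rng_ghost e)
  · intro e
    rcases R.edge_cases e with ⟨s, i, rfl⟩ | ⟨e, rfl⟩
    · rw [toTensorGen_ghost_petal, hs, hv, Algebra.TensorProduct.tmul_mul_tmul, hd, mul_one]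
    · rw [toTensorGen_ghost_residual, hv, Algebra.TensorProduct.tmul_mul_tmul, one_mul]
      exact congrArg (· ⊗ₜ 1) (h1.ghost_src e)
  · intro e
    rcases R.edge_cases e with ⟨s, i, rfl⟩ | ⟨e, rfl⟩
    · rw [toTensorGen_ghost_petal, toTensorGen_edge_petal, R.rng_petal, hv,
        Algebra.TensorProduct.tmul_mul_tmul, hd, h2.ghost_edge_self, gen_rose_vert]
    · rw [toTensorGen_ghost_residual, toTensorGen_edge_residual, hv,
        Algebra.TensorProduct.tmul_mul_tmul, one_mul]
      exact congrArg (· ⊗ₜ 1) (h1.ghost_edge_self e)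
  · intro e d hed
    rcases R.edge_cases e with ⟨s, i, rfl⟩ | ⟨e, rfl⟩ <;>
      rcases R.edge_cases d with ⟨t, j, rfl⟩ | ⟨d, rfl⟩
    · rw [toTensorGen_ghost_petal, toTensorGen_edge_petal, Algebra.TensorProduct.tmul_mul_tmul]
      by_cases hst : s = t
      · subst hst
        rw [h2.ghost_edge_ne i j fun h => hed (by rw [h]), TensorProduct.tmul_zero]
      · rw [h1.vert_ne _ _ fun h => hst (P.head_injective h), TensorProduct.zero_tmul]
    · rw [toTensorGen_ghost_petal, toTensorGen_edge_residual, Algebra.TensorProduct.tmul_mul_tmul,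
        h1.vert_mul_edge_of_ne (d.2 s).symm, TensorProduct.zero_tmul]
    · rw [toTensorGen_ghost_residual, toTensorGen_edge_petal, Algebra.TensorProduct.tmul_mul_tmul,
        h1.ghost_mul_vert_of_ne (e.2 t), TensorProduct.zero_tmul]
    · rw [toTensorGen_ghost_residual, toTensorGen_edge_residual,
        Algebra.TensorProduct.tmul_mul_tmul,
        h1.ghost_edge_ne _ _ fun h => hed (by rw [h]), TensorProduct.zero_tmul]
  · intro v hve
    by_cases h : ∃ s, v = P.head s
    · obtain ⟨s, rfl⟩ := h
      rw [R.sum_src_eq_head (fun e => R.toTensorGen K (edge e) * R.toTensorGen K (ghost e))]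
      simp only [toTensorGen_ghost_petal, toTensorGen_edge_petal, hv,
        Algebra.TensorProduct.tmul_mul_tmul, hd]
      obtain ⟨e, he⟩ := hve
      have := h2.sum_edge_ghost () ⟨(R.petal s).symm ⟨e, he⟩, rfl⟩
      simp only [if_true, gen_rose_vert] at this
      rw [← TensorProduct.tmul_sum, this]
    · have h := not_exists.1 h
      obtain ⟨e, he⟩ := hve
      rw [P.sum_src_eq_of_ne_head
        (fun e => R.toTensorGen K (edge e) * R.toTensorGen K (ghost e)) h, hv,
        ← h1.sum_edge_ghost v ⟨⟨e, he ▸ h⟩, he⟩, TensorProduct.sum_tmul]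
      refine Finset.sum_congr rfl fun d _ => ?_
      split_ifs
      · rw [toTensorGen_ghost_residual, toTensorGen_edge_residual,
          Algebra.TensorProduct.tmul_mul_tmul, one_mul]
      · rw [TensorProduct.zero_tmul]
  · simp only [hv]
    rw [← TensorProduct.sum_tmul, h1.sum_vert]
    rfl

/-- The homomorphism `L_K(E_1) → L_K(E)`. -/
noncomputable def incl : LeavittPathAlgebra K P.residual →ₐ[K] LeavittPathAlgebra K G :=
  lift (P.isLeavittFamily_inclGen (isLeavittFamily_gen K G))

/-- The homomorphism `L_K(1, n) → L_K(E)` that sends `x_i` to the sum of the `p α_{s,i} p*`. -/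
noncomputable def roseHom : LeavittPathAlgebra K (rose n) →ₐ[K] LeavittPathAlgebra K G :=
  lift (R.isLeavittFamily_roseGen (isLeavittFamily_gen K G))

theorem incl_matrixEquiv (M : P.MatrixSum K) : incl K (P.matrixEquiv K M) =
    (isMatrixFamily (P.isLeavittFamily_inclGen (isLeavittFamily_gen K G))).matrixHom K M := by
  change incl K (∑ s, ∑ p, ∑ q, M s p q • (P.headElt (gen K P.residual) ⟨s, p⟩ *
    P.headGhost (gen K P.residual) ⟨s, q⟩)) = ∑ s, ∑ p, ∑ q, M s p q •
      (P.headElt (fun x => gen K G (P.inclGen x)) ⟨s, p⟩ *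
        P.headGhost (fun x => gen K G (P.inclGen x)) ⟨s, q⟩)
  simp only [map_sum, map_smul, map_mul, headElt, headGhost, map_pathElt, map_ghostElt, incl,
    lift_gen]

/-- The images of `L_K(E_1)` and of `L_K(1, n)` commute: the former is spanned by the `p q*`, where
`p` and `q` are paths of `E_1` into the same `v_s`, and these commute with the sums over all paths
`p` of the `p α_{s,i} p*`. -/
theorem commute_incl_roseHom (a : LeavittPathAlgebra K P.residual)
    (b : LeavittPathAlgebra K (rose n)) : Commute (incl K a) (R.roseHom K b) := by
  have hf := isLeavittFamily_gen K G
  obtain ⟨b, rfl⟩ := proj_surjective b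
  obtain ⟨M, rfl⟩ := (P.matrixEquiv K).surjective a
  rw [incl_matrixEquiv]
  induction b using FreeAlgebra.induction with
  | grade0 r =>
    rw [AlgHom.commutes, AlgHom.commutes]
    exact (Algebra.commutes r _).symm
  | grade1 x =>
    rw [show R.roseHom K (proj K (rose n) (FreeAlgebra.ι K x)) = R.roseGen hf x from
      lift_gen _ x]
    cases x with
    | vert v => exact Commute.one_right _
    | edge i =>
      rw [roseGen_edge]
      exact IsMatrixFamily.commute_matrixHom_diag _ K _ (fun s => R.vert_mul_petal hf s i) (fun s => R.petal_mul_vert hf s i) M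
    | ghost i =>
      rw [roseGen_ghost]
      exact IsMatrixFamily.commute_matrixHom_diag _ K _ (fun s => R.vert_mul_petal_ghost hf s i) (fun s => R.petal_ghost_mul_vert hf s i) M
  | mul a b ha hb => rw [map_mul, map_mul]; exact ha.mul_right hb
  | add a b ha hb => rw [map_add, map_add]; exact ha.add_right hb

/-- The homomorphism from `L_K(E)` to the tensor product. -/
noncomputable def toTensor : LeavittPathAlgebra K G →ₐ[K]
    LeavittPathAlgebra K P.residual ⊗[K] LeavittPathAlgebra K (rose n) :=
  lift (R.isLeavittFamily_toTensorGen K)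

/-- The homomorphism from the tensor product to `L_K(E)`. -/
noncomputable def ofTensor : LeavittPathAlgebra K P.residual ⊗[K] LeavittPathAlgebra K (rose n)
    →ₐ[K] LeavittPathAlgebra K G :=
  Algebra.TensorProduct.lift (incl K) (R.roseHom K) (R.commute_incl_roseHom K)

theorem toTensor_incl (a : LeavittPathAlgebra K P.residual) :
    R.toTensor K (incl K a) = a ⊗ₜ 1 := by
  have : (R.toTensor K).comp (incl K) = Algebra.TensorProduct.includeLeft := by
    refine algHom_ext fun x => ?_
    simp only [AlgHom.comp_apply, incl, lift_gen, toTensor, toTensorGen_inclGen,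
      Algebra.TensorProduct.includeLeft_apply]
  exact DFunLike.congr_fun this a

theorem toTensor_diag {a : Fin P.numCycles ⊕ Fin P.numRoses → LeavittPathAlgebra K G}
    {b : LeavittPathAlgebra K (rose n)}
    (ha : ∀ s, R.toTensor K (a s) = gen K P.residual (vert (P.head s)) ⊗ₜ b) :
    R.toTensor K ((isMatrixFamily (P.isLeavittFamily_inclGen (isLeavittFamily_gen K G))).diag a) =
      1 ⊗ₜ b := by
  have h1 := isMatrixFamily (isLeavittFamily_gen K P.residual)
  have hu : ∀ x, P.headElt (fun x => gen K G (P.inclGen x)) x =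
      incl K (P.headElt (gen K P.residual) x) := fun x => by
    simp only [headElt, map_pathElt, incl, lift_gen]
  have hu' : ∀ x, P.headGhost (fun x => gen K G (P.inclGen x)) x =
      incl K (P.headGhost (gen K P.residual) x) := fun x => by
    simp only [headGhost, map_ghostElt, incl, lift_gen]
  simp only [IsMatrixFamily.diag, map_sum, map_mul, hu, hu', toTensor_incl, ha,
    Algebra.TensorProduct.tmul_mul_tmul, one_mul, mul_one, h1.mul_corner]
  rw [← TensorProduct.sum_tmul, h1.sum_mul]

theorem toTensor_comp_ofTensor : (R.toTensor K).comp (R.ofTensor K) = AlgHom.id K _ := by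
  refine Algebra.TensorProduct.ext ?_ ?_
  · ext a
    simp only [AlgHom.comp_apply, Algebra.TensorProduct.includeLeft_apply, ofTensor,
      Algebra.TensorProduct.lift_tmul, map_one, mul_one, toTensor_incl]
    rfl
  · refine algHom_ext fun x => ?_
    simp only [AlgHom.comp_apply, AlgHom.restrictScalars_apply,
      Algebra.TensorProduct.includeRight_apply, ofTensor,
      Algebra.TensorProduct.lift_tmul, map_one, one_mul, roseHom, lift_gen, AlgHom.id_apply]
    cases x with
    | vert v => rw [roseGen, map_one, gen_rose_vert]; rfl
    | edge i => exact R.toTensor_diag K fun s =>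
        (lift_gen _ _).trans (R.toTensorGen_edge_petal K s i)
    | ghost i => exact R.toTensor_diag K fun s =>
        (lift_gen _ _).trans (R.toTensorGen_ghost_petal K s i)

/-- Multiplication by `v_s` picks out the summand of the trivial path at `v_s`, as the other paths of
`E_1` into the `v_t` do not start at the sink `v_s`. -/
theorem vert_mul_diag (a : Fin P.numCycles ⊕ Fin P.numRoses → LeavittPathAlgebra K G)
    (ha : ∀ s, gen K G (vert (P.head s)) * a s = a s)
    (ha' : ∀ s, a s * gen K G (vert (P.head s)) = a s) (s) :
    gen K G (vert (P.head s)) *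
      (isMatrixFamily (P.isLeavittFamily_inclGen (isLeavittFamily_gen K G))).diag a = a s :=
  ((isMatrixFamily (P.isLeavittFamily_inclGen (isLeavittFamily_gen K G))).mul_diag a ha
    (P.trivialPath s)).trans (ha' s)

theorem ofTensor_comp_toTensor : (R.ofTensor K).comp (R.toTensor K) = AlgHom.id K _ := by
  have hf := isLeavittFamily_gen K G
  refine algHom_ext fun x => ?_
  have hincl : ∀ y, R.ofTensor K (gen K P.residual y ⊗ₜ 1) = gen K G (P.inclGen y) := fun y => by
    rw [ofTensor, Algebra.TensorProduct.lift_tmul, map_one, mul_one, incl, lift_gen]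
  have hrose : ∀ s y, R.ofTensor K (gen K P.residual (vert (P.head s)) ⊗ₜ gen K (rose n) y) =
      gen K G (vert (P.head s)) * R.roseGen hf y := fun s y => by
    rw [ofTensor, Algebra.TensorProduct.lift_tmul, incl, lift_gen, roseHom, lift_gen]
    rfl
  rw [AlgHom.comp_apply, toTensor, lift_gen, AlgHom.id_apply]
  cases x with
  | vert v => exact hincl (vert v)
  | edge e =>
    rcases R.edge_cases e with ⟨s, i, rfl⟩ | ⟨e, rfl⟩
    · rw [toTensorGen_edge_petal, hrose]
      exact vert_mul_diag K (fun s => gen K G (edge (R.petal s i).1))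
        (fun s => R.vert_mul_petal hf s i) (fun s => R.petal_mul_vert hf s i) s
    · rw [toTensorGen_edge_residual]
      exact hincl (edge e)
  | ghost e =>
    rcases R.edge_cases e with ⟨s, i, rfl⟩ | ⟨e, rfl⟩
    · rw [toTensorGen_ghost_petal, hrose]
      exact vert_mul_diag K (fun s => gen K G (ghost (R.petal s i).1))
        (fun s => R.vert_mul_petal_ghost hf s i) (fun s => R.petal_ghost_mul_vert hf s i) s
    · rw [toTensorGen_ghost_residual]
      exact hincl (ghost e)

theorem diag_mem {d : ℤ} {a : Fin P.numCycles ⊕ Fin P.numRoses → LeavittPathAlgebra K G}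
    (ha : ∀ s, a s ∈ grading K G d) :
    (isMatrixFamily (P.isLeavittFamily_inclGen (isLeavittFamily_gen K G))).diag a ∈
      grading K G d := by
  have hg : ∀ y, gen K G (P.inclGen y) ∈ grading K G y.deg := fun y => by
    rw [← P.deg_inclGen y]
    exact gen_mem_grading _
  unfold IsMatrixFamily.diag
  refine sum_mem fun x _ => ?_
  have h1 : P.headElt (fun y => gen K G (P.inclGen y)) x ∈ grading K G x.2.edges.length :=
    pathElt_mem (G := P.residual) (f := fun y => gen K G (P.inclGen y)) hg _ _
  have h2 : P.headGhost (fun y => gen K G (P.inclGen y)) x ∈ grading K G (-x.2.edges.length) :=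
    ghostElt_mem (G := P.residual) (f := fun y => gen K G (P.inclGen y)) hg _ _
  have := SetLike.GradedMul.mul_mem (SetLike.GradedMul.mul_mem h1 (ha x.1)) h2
  rwa [add_comm _ d, add_neg_cancel_right] at this

theorem gradedAlgIso_tensor (R : P.RoseHeads n) : GradedAlgIso K (grading K G)
    (tensorGrading (grading K P.residual) (grading K (rose n))) := by
  refine GradedAlgIso.of_algEquiv (AlgEquiv.ofAlgHom (R.toTensor K) (R.ofTensor K)
    (R.toTensor_comp_ofTensor K) (R.ofTensor_comp_toTensor K)) (fun k a ha => ?_) fun k b hb => ?_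
  · refine map_mem_of_gen (fun k c b hb => Submodule.smul_mem _ c hb) (R.toTensor K)
      (fun x => ?_) ha
    rw [toTensor, lift_gen]
    exact R.toTensorGen_mem K x
  · refine lift_mem_of_mem_tensorGrading (fun k c b hb => Submodule.smul_mem _ c hb)
      (R.commute_incl_roseHom K) (fun i a ha => ?_) (fun j b hb => ?_) hb
    · refine map_mem_of_gen (fun k c b hb => Submodule.smul_mem _ c hb) (incl K) (fun x => ?_) ha
      rw [incl, lift_gen]
      rw [← P.deg_inclGen x]
      exact gen_mem_grading _
    · refine map_mem_of_gen (fun k c b hb => Submodule.smul_mem _ c hb) (R.roseHom K)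
        (fun x => ?_) hb
      rw [roseHom, lift_gen]
      cases x with
      | vert v => exact SetLike.GradedOne.one_mem
      | edge i =>
        rw [roseGen_edge]
        exact diag_mem K (d := 1) fun s => gen_mem_grading (edge (R.petal s i).1)
      | ghost i =>
        rw [roseGen_ghost]
        exact diag_mem K (d := -1) fun s => gen_mem_grading (ghost (R.petal s i).1)

end Tensor

end RoseHeads

end DirGraph.Polycephaly

/-! ### Group rings -/

section GroupRing

variable {K : Type*} [Field K] {A : Type*} [Ring A] [Algebra K A]

theorem single_mem_groupRingGrading {σ : Type*} [SetLike σ A] [AddSubgroupClass σ A] {𝒜 : ℤ → σ}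
    {i j : ℤ} {a : A} (ha : a ∈ 𝒜 i) :
    AddMonoidAlgebra.single j a ∈ groupRingGrading 𝒜 (i + j) := by
  intro k
  rw [AddMonoidAlgebra.coeff_single]
  rcases eq_or_ne k j with rfl | hk
  · rwa [Finsupp.single_eq_same, add_sub_cancel_right]
  · rw [Finsupp.single_eq_of_ne hk]
    exact zero_mem _

theorem eq_sum_single (x : AddMonoidAlgebra A ℤ) :
    x = ∑ j ∈ x.coeff.support, AddMonoidAlgebra.single j (x.coeff j) := by
  ext j
  rw [AddMonoidAlgebra.coeff_sum, Finsupp.finsetSum_apply]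
  simp only [AddMonoidAlgebra.coeff_single, Finsupp.single_apply, Finset.sum_ite_eq']
  split_ifs with h
  · rfl
  · exact Finsupp.notMem_support_iff.1 h

instance {𝒜 : ℤ → Submodule K A} [SetLike.GradedMonoid 𝒜] :
    SetLike.GradedMonoid (groupRingGrading 𝒜) where
  one_mem := single_mem_groupRingGrading (i := 0) (j := 0) SetLike.GradedOne.one_mem
  mul_mem i j x y hx hy := by
    rw [eq_sum_single x, eq_sum_single y, Finset.sum_mul_sum]
    refine sum_mem fun k _ => sum_mem fun l _ => ?_
    rw [AddMonoidAlgebra.single_mul_single]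
    have := single_mem_groupRingGrading (𝒜 := 𝒜) (j := k + l)
      (SetLike.GradedMul.mul_mem (hx k) (hy l))
    rwa [show i - k + (j - l) + (k + l) = i + j by ring] at this

/-- Passage to the group ring respects graded isomorphisms. -/
theorem GradedAlgIso.groupRing {B : Type*} [Ring B] [Algebra K B] {𝒜 : ℤ → Submodule K A}
    {ℬ : ℤ → Submodule K B} (h : GradedAlgIso K 𝒜 ℬ) :
    GradedAlgIso K (groupRingGrading 𝒜) (groupRingGrading ℬ) := by
  obtain ⟨φ, hφ⟩ := h
  refine ⟨AddMonoidAlgebra.mapAlgEquiv K ℤ φ, fun k a => forall_congr' fun j => ?_⟩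
  rw [hφ]
  simp

open LeavittPathAlgebra in
/-- The petal of `L_K(1, 1)` is a unit: this algebra is the ring of Laurent polynomials. -/
noncomputable def roseUnit (K : Type*) [Field K] : (LeavittPathAlgebra K (DirGraph.rose 1))ˣ where
  val := gen K _ (edge 0)
  inv := gen K _ (ghost 0)
  val_inv := by
    have := (isLeavittFamily_gen K (DirGraph.rose 1)).sum_edge_ghost () ⟨0, rfl⟩
    simpa [LeavittPathAlgebra.gen_rose_vert] using this
  inv_val := by
    rw [(isLeavittFamily_gen K (DirGraph.rose 1)).ghost_edge_self,
      LeavittPathAlgebra.gen_rose_vert]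

theorem roseUnit_zpow_mem (j : ℤ) :
    ((roseUnit K ^ j : (LeavittPathAlgebra K (DirGraph.rose 1))ˣ) :
      LeavittPathAlgebra K (DirGraph.rose 1)) ∈ LeavittPathAlgebra.grading K (DirGraph.rose 1) j := by
  have h1 := LeavittPathAlgebra.gen_mem_grading (K := K) (G := DirGraph.rose 1) (edge 0)
  have h2 := LeavittPathAlgebra.gen_mem_grading (K := K) (G := DirGraph.rose 1) (ghost 0)
  cases j with
  | ofNat m =>
    have := SetLike.pow_mem_graded m h1
    simpa [deg, roseUnit] using this
  | negSucc m =>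
    have := SetLike.pow_mem_graded (m + 1) h2
    rw [zpow_negSucc, ← inv_pow, Units.val_pow_eq_pow_val]
    rw [show (Int.negSucc m) = (m + 1) • deg (ghost 0 : LeavittGen Unit (Fin 1)) by
      simp [deg, Int.negSucc_eq]]
    exact this

/-- The generators of `L_K(1, 1)` in the group ring. -/
noncomputable def groupRingGen (A : Type*) [Ring A] :
    LeavittGen Unit (Fin 1) → AddMonoidAlgebra A ℤ
  | vert _ => 1
  | edge _ => .single 1 1
  | ghost _ => .single (-1) 1

theorem isLeavittFamily_groupRingGen :
    IsLeavittFamily (DirGraph.rose 1) (groupRingGen A) where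
  vert_self _ := one_mul _
  vert_ne v w h := absurd rfl h
  src_edge _ := one_mul _
  edge_rng _ := mul_one _
  rng_ghost _ := one_mul _
  ghost_src _ := mul_one _
  ghost_edge_self i := by
    refine (AddMonoidAlgebra.single_mul_single _ _ _ _).trans ?_
    rw [mul_one, neg_add_cancel]
    rfl
  ghost_edge_ne i j h := absurd (Subsingleton.elim i j) h
  sum_edge_ghost v _ := by
    rw [Fintype.sum_subsingleton _ 0, if_pos (Subsingleton.elim _ _)]
    refine (AddMonoidAlgebra.single_mul_single _ _ _ _).trans ?_
    rw [mul_one, add_neg_cancel]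
    rfl
  sum_vert := by simp [groupRingGen]

theorem commute_single_one (j : ℤ) (x : AddMonoidAlgebra A ℤ) :
    Commute x (AddMonoidAlgebra.single j 1) := by
  induction x using AddMonoidAlgebra.induction_linear with
  | zero => exact Commute.zero_left _
  | add x y hx hy => exact hx.add_left hy
  | single n r =>
    rw [Commute, SemiconjBy, AddMonoidAlgebra.single_mul_single,
      AddMonoidAlgebra.single_mul_single, add_comm, one_mul, mul_one]

/-- Tensoring a graded algebra with `L_K(1, 1)` gives its group ring over `ℤ`. -/
theorem gradedAlgIso_tensor_groupRing (𝒜 : ℤ → Submodule K A) [SetLike.GradedMonoid 𝒜] :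
    GradedAlgIso K (tensorGrading 𝒜 (LeavittPathAlgebra.grading K (DirGraph.rose 1)))
      (groupRingGrading 𝒜) := by
  have hcomm : ∀ a b, Commute (AddMonoidAlgebra.singleZeroAlgHom (R := K) (A := A) (M := ℤ) a)
      (LeavittPathAlgebra.lift (K := K) (isLeavittFamily_groupRingGen (A := A)) b) := by
    intro a b
    obtain ⟨b, rfl⟩ := LeavittPathAlgebra.proj_surjective b
    induction b using FreeAlgebra.induction with
    | grade0 r =>
      rw [AlgHom.commutes, AlgHom.commutes]
      exact (Algebra.commutes r _).symm
    | grade1 x =>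
      rw [show LeavittPathAlgebra.lift (K := K) (isLeavittFamily_groupRingGen (A := A))
        (LeavittPathAlgebra.proj K _ (FreeAlgebra.ι K x)) = groupRingGen A x from
          LeavittPathAlgebra.lift_gen _ x]
      cases x with
      | vert v => exact Commute.one_right _
      | edge i => exact commute_single_one _ _
      | ghost i => exact commute_single_one _ _
    | mul a b ha hb => rw [map_mul, map_mul]; exact ha.mul_right hb
    | add a b ha hb => rw [map_add, map_add]; exact ha.add_right hb
  let Φ := Algebra.TensorProduct.lift (AddMonoidAlgebra.singleZeroAlgHom (R := K) (A := A) (M := ℤ))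
    (LeavittPathAlgebra.lift (K := K) (isLeavittFamily_groupRingGen (A := A))) hcomm
  let g : Multiplicative ℤ →* A ⊗[K] LeavittPathAlgebra K (DirGraph.rose 1) :=
    (Algebra.TensorProduct.includeRight (R := K) (A := A)).toMonoidHom.comp
      ((Units.coeHom _).comp (zpowersHom _ (roseUnit K)))
  have hg : ∀ j, g (Multiplicative.ofAdd j) = 1 ⊗ₜ
    ((roseUnit K ^ j : (LeavittPathAlgebra K (DirGraph.rose 1))ˣ) :
      LeavittPathAlgebra K (DirGraph.rose 1)) := fun j => by simp [g]
  let Ψ := AddMonoidAlgebra.liftNCAlgHom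
    (Algebra.TensorProduct.includeLeft (R := K) (S := K) (A := A)
      (B := LeavittPathAlgebra K (DirGraph.rose 1))) g (fun a j => by
        obtain ⟨j, rfl⟩ := Multiplicative.ofAdd.surjective j
        rw [hg, Commute, SemiconjBy]
        simp)
  have hΨ : ∀ j a, Ψ (AddMonoidAlgebra.single j a) = a ⊗ₜ
      ((roseUnit K ^ j : (LeavittPathAlgebra K (DirGraph.rose 1))ˣ) :
        LeavittPathAlgebra K (DirGraph.rose 1)) := fun j a => by
    rw [AddMonoidAlgebra.coe_liftNCAlgHom, AddMonoidAlgebra.liftNC_single, hg]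
    simp
  have hlift : ∀ j : ℤ, LeavittPathAlgebra.lift (K := K) (isLeavittFamily_groupRingGen (A := A))
      ((roseUnit K ^ j : (LeavittPathAlgebra K (DirGraph.rose 1))ˣ) :
        LeavittPathAlgebra K (DirGraph.rose 1)) = AddMonoidAlgebra.single j 1 := by
    have : (LeavittPathAlgebra.lift (K := K)
        (isLeavittFamily_groupRingGen (A := A))).toMonoidHom.comp
        ((Units.coeHom _).comp (zpowersHom _ (roseUnit K))) = AddMonoidAlgebra.of A ℤ := by
      refine MonoidHom.ext_mint ?_
      simp only [MonoidHom.comp_apply, zpowersHom_apply, toAdd_ofAdd, zpow_one]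
      exact LeavittPathAlgebra.lift_gen _ _
    exact fun j => DFunLike.congr_fun this (Multiplicative.ofAdd j)
  have hΦ : ∀ a j, Φ (a ⊗ₜ ((roseUnit K ^ j : (LeavittPathAlgebra K (DirGraph.rose 1))ˣ) :
      LeavittPathAlgebra K (DirGraph.rose 1))) = AddMonoidAlgebra.single j a := fun a j => by
    rw [Algebra.TensorProduct.lift_tmul, hlift]
    refine (AddMonoidAlgebra.single_mul_single _ _ _ _).trans ?_
    rw [zero_add, mul_one]
  have hΦΨ : ∀ x, Φ (Ψ x) = x := fun x => by
    induction x using AddMonoidAlgebra.induction_linear with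
    | zero => rw [map_zero, map_zero]
    | add x y hx hy => rw [map_add, map_add, hx, hy]
    | single j a => rw [hΨ, hΦ]
  have hΨΦ : Ψ.comp Φ = AlgHom.id K _ := by
    refine Algebra.TensorProduct.ext ?_ ?_
    · ext a
      have := hΨ 0 a
      rw [zpow_zero, Units.val_one] at this
      rw [← hΦ a 0] at this
      simpa using this
    · refine LeavittPathAlgebra.algHom_ext fun x => ?_
      have hx : ∃ j : ℤ, LeavittPathAlgebra.gen K (DirGraph.rose 1) x =
          ((roseUnit K ^ j : (LeavittPathAlgebra K (DirGraph.rose 1))ˣ) :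
            LeavittPathAlgebra K (DirGraph.rose 1)) := by
        cases x with
        | vert v => exact ⟨0, by simp [LeavittPathAlgebra.gen_rose_vert]⟩
        | edge i => exact ⟨1, by rw [zpow_one, Subsingleton.elim i 0]; rfl⟩
        | ghost i => exact ⟨-1, by rw [zpow_neg_one, Subsingleton.elim i 0]; rfl⟩
      obtain ⟨j, hj⟩ := hx
      change Ψ (Φ (1 ⊗ₜ LeavittPathAlgebra.gen K (DirGraph.rose 1) x)) = 1 ⊗ₜ _
      rw [hj, hΦ, hΨ]
  have hsmul : ∀ k (c : K), ∀ x ∈ groupRingGrading 𝒜 k, c • x ∈ groupRingGrading 𝒜 k :=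
    fun k c x hx j => Submodule.smul_mem _ c (hx j)
  refine GradedAlgIso.of_algEquiv (AlgEquiv.ofAlgHom Φ Ψ (AlgHom.ext hΦΨ) hΨΦ)
    (fun k x hx => ?_) fun k x hx => ?_
  · refine lift_mem_of_mem_tensorGrading hsmul hcomm (fun i a ha => ?_) (fun j b hb => ?_) hx
    · have := single_mem_groupRingGrading (𝒜 := 𝒜) (j := 0) ha
      rwa [add_zero] at this
    · refine LeavittPathAlgebra.map_mem_of_gen hsmul _ (fun y => ?_) hb
      rw [LeavittPathAlgebra.lift_gen]
      have h1 : ∀ j : ℤ, AddMonoidAlgebra.single j 1 ∈ groupRingGrading 𝒜 j := fun j => by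
        have := single_mem_groupRingGrading (𝒜 := 𝒜) (j := j)
          (SetLike.GradedOne.one_mem (A := 𝒜))
        rwa [zero_add] at this
      cases y with
      | vert v => exact h1 0
      | edge i => exact h1 1
      | ghost i => exact h1 (-1)
  · change Ψ x ∈ _
    rw [eq_sum_single x, map_sum]
    refine sum_mem fun j _ => ?_
    rw [hΨ, ← sub_add_cancel k j]
    exact tmul_mem_tensorGrading (hx j) (roseUnit_zpow_mem j)

end GroupRing

namespace DirGraph.Polycephaly

variable {V E : Type*} {G : DirGraph V E} (P : G.Polycephaly)

theorem nonempty_roseHeads_of_numPetals [Finite E] {n : ℕ} (h0 : P.numCycles = 0)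
    (h : ∀ s, P.numPetals s = n) : Nonempty (P.RoseHeads n) := by
  have hP : ∀ s, Nonempty (Fin n ≃ {e : E // G.src e = P.head s}) := by
    rintro (s | s)
    · exact (Fin.cast h0 s).elim0
    · exact ⟨(Finite.equivFinOfCardEq (h s)).symm⟩
  refine ⟨⟨fun s => (hP s).some, ?_⟩⟩
  rintro (s | s) i
  · exact (Fin.cast h0 s).elim0
  · exact P.rose_no_exit s _ ((hP (Sum.inr s)).some i).2

theorem nonempty_roseHeads_of_allHeadsAreLoops [Finite E] (h : P.AllHeadsAreLoops) :
    Nonempty (P.RoseHeads 1) := by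
  have hc : ∀ s, ∃ c, P.cyc s = [c] ∧ G.src c = P.cycVertex s ∧ G.rng c = P.cycVertex s := by
    intro s
    obtain ⟨c, hc⟩ := List.length_eq_one_iff.1 (h.1 s)
    have := (P.isCycle s).2.1
    rw [hc] at this
    exact ⟨c, hc, this⟩
  have huniq : ∀ s c, P.cyc s = [c] → G.src c = P.cycVertex s → ∀ e, G.src e = P.cycVertex s →
      e = c := by
    intro s c hcyc hsrc e he
    have := P.cyc_no_exit s c (by simp [hcyc]) e (he.trans hsrc.symm)
    simpa [hcyc] using this
  have hP : ∀ s, Nonempty (Fin 1 ≃ {e : E // G.src e = P.head s}) := by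
    rintro (s | s)
    · obtain ⟨c, hcyc, hsrc, -⟩ := hc s
      have : Unique {e : E // G.src e = P.head (Sum.inl s)} :=
        ⟨⟨⟨c, hsrc⟩⟩, fun e => Subtype.ext (huniq s c hcyc hsrc e.1 e.2)⟩
      exact ⟨Equiv.ofUnique _ _⟩
    · exact ⟨(Finite.equivFinOfCardEq (h.2 s)).symm⟩
  refine ⟨⟨fun s => (hP s).some, ?_⟩⟩
  rintro (s | s) i
  · obtain ⟨c, hcyc, hsrc, hrng⟩ := hc s
    rw [huniq s c hcyc hsrc _ ((hP (Sum.inl s)).some i).2]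
    exact hrng
  · exact P.rose_no_exit s _ ((hP (Sum.inr s)).some i).2

end DirGraph.Polycephaly

theorem mainTheorem4 {K : Type*} [Field K] {V E : Type*} [Finite V] [Finite E]
    (G : DirGraph V E) (P : G.Polycephaly) :
    (∀ n : ℕ, P.numCycles = 0 → (∀ s, P.numPetals s = n) →
      GradedAlgIso K (LeavittPathAlgebra.grading K G)
        (tensorGrading (LeavittPathAlgebra.grading K P.residual)
          (LeavittPathAlgebra.grading K (DirGraph.rose n)))) ∧
    (GradedAlgIso K (LeavittPathAlgebra.grading K G)
        (groupRingGrading (P.matrixSumGrading K)) ↔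
      P.AllHeadsAreLoops) ∧
    (∀ (A : Type*) [Ring A] (𝒜 : ℤ → AddSubgroup A) [GradedRing 𝒜],
      GradedRingIso (LeavittPathAlgebra.grading K G) (groupRingGrading 𝒜) →
        P.AllHeadsAreLoops) := by
  classical
  have := Fintype.ofFinite V
  have := Fintype.ofFinite E
  have hgr : SetLike.GradedMonoid (P.matrixSumGrading K) :=
    inferInstanceAs (SetLike.GradedMonoid (matrixGrading K _))
  refine ⟨fun n h0 h => ?_, ⟨fun h => ?_, fun h => ?_⟩, fun A _ 𝒜 _ h => ?_⟩
  · obtain ⟨R⟩ := P.nonempty_roseHeads_of_numPetals h0 h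
    exact R.gradedAlgIso_tensor K
  · exact P.allHeadsAreLoops_of_gradedRingIso K _ SetLike.GradedOne.one_mem h.gradedRingIso
  · obtain ⟨R⟩ := P.nonempty_roseHeads_of_allHeadsAreLoops h
    exact (R.gradedAlgIso_tensor K).trans
      ((gradedAlgIso_tensor_groupRing _).trans (P.gradedAlgIso_matrixSum K).groupRing)
  · exact P.allHeadsAreLoops_of_gradedRingIso K 𝒜 SetLike.GradedOne.one_mem h
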